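/- **Theorem 3.1.** For $\beta\in\{1,-1\}$ put $\gamma(\xi)=\sqrt{\xi^2-\beta\xi^4+\xi^6}$ and $\langle x\rangle=1+|x|$. Let $\widehat u(\tau,\xi)$ denote the space-time Fourier transform, $\widehat u(\tau,\xi)=\int_{\mathbb R^2}e^{-i(t\tau+x\xi)}u(t,x)\,dt\,dx$ for Schwartz functions (extended to tempered distributions), and $\vee$ its inverse. For $s,b\in\mathbb R$ let $X^{s,b}$ be the completion of $\mathcal S(\mathbb R^2)$, realized inside $\mathcal S'(\mathbb R^2)$, with respect to the norm $$\|u\|_{X^{s,b}}=\big\|\langle|\tau|-\gamma(\xi)\rangle^{b}\langle\xi\rangle^{s}\,\widehat u(\tau,\xi)\big\|_{L^2_{\tau,\xi}(\mathbb R^2)} .$$ Let $b>1/2$ and $1/6<a<1/2$, and suppose that either (i) $s\ge 0$, or (ii) $-1/2<s<0$ and $|s|<a$. Then there is a constant $c>0$, depending only on $a,b,s$, such that for $\beta=\pm1$ and all $u,v\in X^{s,b}$ the following holds. The product $uv$ is well defined as a tempered distribution through $\widehat{uv}(\tau,\xi)=(2\pi)^{-2}\int_{\mathbb R^2}\widehat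 u(\tau_1,\xi_1)\,\widehat v(\tau-\tau_1,\xi-\xi_1)\,d\tau_1\,d\xi_1$, where the integral converges absolutely for almost every $(\tau,\xi)$ (for Schwartz functions this is the pointwise product), the distribution $\left(\frac{|\xi|^2\,\widehat{uv}(\tau,\xi)}{2i\gamma(\xi)}\right)^{\vee}$ belongs to $X^{s,-a}$, and $$\left\|\left(\frac{|\xi|^2\,\widehat{uv}(\tau,\xi)}{2i\gamma(\xi)}\right)^{\vee}\right\|_{X^{s,-a}}\le c\,\|u\|_{X^{s,b}}\,\|v\|_{X^{s,b}} .$$ -/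

import Mathlib

open MeasureTheory SchwartzMap FourierTransform
open scoped ENNReal

noncomputable section

/-- The space-time plane. On the physical side a point is `(t, x)`, on the Fourier side it is
`(τ, ξ)`; the coordinate `0` is `t` or `τ`, the coordinate `1` is `x` or `ξ`. -/
abbrev Plane : Type := EuclideanSpace ℝ (Fin 2)

/-- `⟨x⟩ = 1 + |x|`. -/
def japanese (x : ℝ) : ℝ := 1 + |x|

/-- `γ(ξ) = √(ξ² - β ξ⁴ + ξ⁶)`. -/
def dispersion (β ξ : ℝ) : ℝ := Real.sqrt (ξ ^ 2 - β * ξ ^ 4 + ξ ^ 6)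

/-- The weight `⟨|τ| - γ(ξ)⟩^b ⟨ξ⟩^s` at the point `η = (τ, ξ)`. -/
def xWeight (β s b : ℝ) (η : Plane) : ℝ :=
  japanese (|η 0| - dispersion β (η 1)) ^ b * japanese (η 1) ^ s

/-- The space-time Fourier transform `∫ e^{-i(tτ + xξ)} φ(t, x) dt dx`. -/
def spaceTimeFourier (φ : Plane → ℂ) (η : Plane) : ℂ :=
  ∫ y : Plane, Complex.exp (-(Complex.I * ((y 0 * η 0 + y 1 * η 1 : ℝ) : ℂ))) * φ y

/-- The space-time Fourier transform of the tempered distribution `u` is the function `f`, that is,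
`û = f`. Mathlib's `𝓕` has the kernel `e^{-2πi⟨y, ζ⟩}`, so `û(2πζ) = (𝓕 u)(ζ)`. -/
def HasSpaceTimeFourier (u : 𝓢'(Plane, ℂ)) (f : Plane → ℂ) : Prop :=
  AEStronglyMeasurable f volume ∧
    ∀ φ : 𝓢(Plane, ℂ),
      Integrable (fun ζ : Plane => φ ζ * f ((2 * Real.pi) • ζ)) volume ∧
        (𝓕 u) φ = ∫ ζ : Plane, φ ζ * f ((2 * Real.pi) • ζ)

/-- The norm `‖⟨|τ| - γ(ξ)⟩^b ⟨ξ⟩^s û(τ, ξ)‖_{L²(dτ dξ)}` of a tempered distribution, with the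
value `∞` if `û` is not a function or the norm is not finite. (The function `û` is unique up to
null sets, so there is at most one value in the infimum.) -/
def xNorm (β s b : ℝ) (u : 𝓢'(Plane, ℂ)) : ℝ≥0∞ :=
  ⨅ (f : Plane → ℂ) (_ : HasSpaceTimeFourier u f),
    eLpNorm (fun η => (xWeight β s b η : ℂ) * f η) 2 volume

/-- `X^{s,b}`: the completion of the Schwartz class for `xNorm`, realized as the set of those
tempered distributions that are limits of Schwartz functions in this norm. -/
def XSpace (β s b : ℝ) : Set 𝓢'(Plane, ℂ) :=
  {u | ∀ ε : ℝ≥0∞, 0 < ε →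
    ∃ φ : 𝓢(Plane, ℂ), xNorm β s b (u - toTemperedDistributionCLM Plane ℂ volume φ) < ε}

/-- `P` is the product `uv`: the integral `∫ û(η') v̂(η - η') dη'` converges absolutely for almost
every `η = (τ, ξ)`, and `P̂(η) = (2π)⁻² ∫ û(η') v̂(η - η') dη'`. -/
def IsProduct (u v P : 𝓢'(Plane, ℂ)) : Prop :=
  ∃ f g : Plane → ℂ, HasSpaceTimeFourier u f ∧ HasSpaceTimeFourier v g ∧
    (∀ᵐ η : Plane, Integrable (fun η' : Plane => f η' * g (η - η')) volume) ∧
    HasSpaceTimeFourier P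
      (fun η => ((2 * Real.pi) ^ 2 : ℂ)⁻¹ * ∫ η' : Plane, f η' * g (η - η'))

/-- `w = (m P̂)^∨`. -/
def IsMultiplied (m : Plane → ℂ) (P w : 𝓢'(Plane, ℂ)) : Prop :=
  ∃ F : Plane → ℂ, HasSpaceTimeFourier P F ∧ HasSpaceTimeFourier w (fun η => m η * F η)

/-- The multiplier `|ξ|² / (2iγ(ξ))`. -/
def nonlinearMultiplier (β : ℝ) (η : Plane) : ℂ :=
  ((|η 1| ^ 2 : ℝ) : ℂ) / (2 * Complex.I * (dispersion β (η 1) : ℂ))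

/-- The function `û` is unique up to null sets. -/
theorem HasSpaceTimeFourier.ae_eq {u : 𝓢'(Plane, ℂ)} {f g : Plane → ℂ}
    (hf : HasSpaceTimeFourier u f) (hg : HasSpaceTimeFourier u g) : f =ᵐ[volume] g := by
  have hpi : (2 * Real.pi) ≠ 0 := by positivity
  have key : ∀ {h : Plane → ℂ}, HasSpaceTimeFourier u h →
      LocallyIntegrable (fun ζ : Plane => h ((2 * Real.pi) • ζ)) volume := by
    intro h hh x
    let ρ : ContDiffBump x := ⟨1, 2, one_pos, one_lt_two⟩
    have h1 : HasCompactSupport (Complex.ofRealCLM ∘ ρ) := ρ.hasCompactSupport.comp_left rfl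
    have h2 : ContDiff ℝ ((⊤ : ℕ∞) : WithTop ℕ∞) (Complex.ofRealCLM ∘ ρ) :=
      Complex.ofRealCLM.contDiff.comp ρ.contDiff
    refine ⟨Metric.closedBall x 1, Metric.closedBall_mem_nhds x one_pos, ?_⟩
    refine ((hh.2 (h1.toSchwartzMap h2)).1.integrableOn).congr_fun ?_
      Metric.isClosed_closedBall.measurableSet
    intro ζ hζ
    simp [ρ.one_of_mem_closedBall hζ]
  have hdil : (fun ζ : Plane => f ((2 * Real.pi) • ζ)) =ᵐ[volume]
      (fun ζ : Plane => g ((2 * Real.pi) • ζ)) := by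
    refine ae_eq_of_integral_contDiff_smul_eq (key hf) (key hg) ?_
    intro ρ hρ hρc
    have h1 : HasCompactSupport (Complex.ofRealCLM ∘ ρ) := hρc.comp_left rfl
    have h2 : ContDiff ℝ ((⊤ : ℕ∞) : WithTop ℕ∞) (Complex.ofRealCLM ∘ ρ) := by fun_prop
    have h3 := (hf.2 (h1.toSchwartzMap h2)).2.symm.trans (hg.2 (h1.toSchwartzMap h2)).2
    simpa using h3
  have hq : Measure.QuasiMeasurePreserving (fun η : Plane => (2 * Real.pi)⁻¹ • η)
      volume volume := by
    refine ⟨by fun_prop, ?_⟩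
    rw [Measure.map_addHaar_smul volume (inv_ne_zero hpi)]
    exact Measure.smul_absolutelyContinuous
  have := hq.ae_eq_comp hdil
  filter_upwards [this] with η hη
  simpa only [Function.comp_def, smul_smul, mul_inv_cancel₀ hpi, one_smul] using hη

/-- `xNorm` is the weighted norm of `û`. -/
theorem HasSpaceTimeFourier.xNorm_eq {u : 𝓢'(Plane, ℂ)} {f : Plane → ℂ}
    (hf : HasSpaceTimeFourier u f) (β s b : ℝ) :
    xNorm β s b u = eLpNorm (fun η => (xWeight β s b η : ℂ) * f η) 2 volume := by
  refine le_antisymm (iInf₂_le f hf) (le_iInf₂ fun g hg => le_of_eq ?_)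
  refine eLpNorm_congr_ae ?_
  filter_upwards [hf.ae_eq hg] with η hη
  rw [hη]

theorem spaceTimeFourier_eq (φ : 𝓢(Plane, ℂ)) (η : Plane) :
    spaceTimeFourier φ η = 𝓕 φ ((2 * Real.pi)⁻¹ • η) := by
  have hpi : (2 * Real.pi) ≠ 0 := by positivity
  obtain ⟨ζ, rfl⟩ : ∃ ζ : Plane, η = (2 * Real.pi) • ζ :=
    ⟨(2 * Real.pi)⁻¹ • η, by rw [smul_smul, mul_inv_cancel₀ hpi, one_smul]⟩
  rw [smul_smul, inv_mul_cancel₀ hpi, one_smul, SchwartzMap.fourier_coe, Real.fourier_eq',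
    spaceTimeFourier]
  congr 1 with y
  rw [smul_eq_mul]
  congr 2
  simp [PiLp.inner_apply, Fin.sum_univ_two]
  ring

/-- For Schwartz functions `û` is given by the integral. -/
theorem hasSpaceTimeFourier_schwartz (φ : 𝓢(Plane, ℂ)) :
    HasSpaceTimeFourier (toTemperedDistributionCLM Plane ℂ volume φ) (spaceTimeFourier φ) := by
  have hpi : (2 * Real.pi) ≠ 0 := by positivity
  have h2 : ∀ ζ : Plane, spaceTimeFourier φ ((2 * Real.pi) • ζ) = 𝓕 φ ζ := by
    intro ζ
    rw [spaceTimeFourier_eq, smul_smul, inv_mul_cancel₀ hpi, one_smul]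
  refine ⟨?_, fun ψ => ?_⟩
  · rw [funext (spaceTimeFourier_eq φ)]
    exact ((𝓕 φ).continuous.comp (continuous_const_smul _)).aestronglyMeasurable
  · simp only [h2]
    constructor
    · exact (SchwartzMap.pairing (ContinuousLinearMap.mul ℂ ℂ) ψ (𝓕 φ)).integrable
    · rw [TemperedDistribution.fourier_toTemperedDistributionCLM_eq]
      simp

/-- For Schwartz functions the product is the pointwise product. -/
theorem isProduct_schwartz (φ ψ : 𝓢(Plane, ℂ)) :
    IsProduct (toTemperedDistributionCLM Plane ℂ volume φ)
      (toTemperedDistributionCLM Plane ℂ volume ψ)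
      (toTemperedDistributionCLM Plane ℂ volume
        (SchwartzMap.pairing (ContinuousLinearMap.mul ℂ ℂ) φ ψ)) := by
  have hpi : (2 * Real.pi) ≠ 0 := by positivity
  have h𝓕𝓕 : ∀ (χ : 𝓢(Plane, ℂ)) (x : Plane), 𝓕 (𝓕 χ) x = χ (-x) := by
    intro χ x
    have h1 : 𝓕⁻ (𝓕 χ) (-x) = χ (-x) := by simp
    rw [← h1, SchwartzMap.fourierInv_coe, SchwartzMap.fourier_coe,
      Real.fourierInv_eq_fourier_neg, neg_neg]
  have hconv : ∀ x : Plane,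
      𝓕 (SchwartzMap.pairing (ContinuousLinearMap.mul ℂ ℂ) φ ψ) x =
        ∫ y : Plane, 𝓕 φ y * 𝓕 ψ (x - y) := by
    intro x
    have h1 := SchwartzMap.convolution_apply (ContinuousLinearMap.mul ℂ ℂ) (𝓕 φ) (𝓕 ψ) x
    have h2 : SchwartzMap.convolution (ContinuousLinearMap.mul ℂ ℂ) (𝓕 φ) (𝓕 ψ) =
        𝓕⁻ (SchwartzMap.pairing (ContinuousLinearMap.mul ℂ ℂ) (𝓕 (𝓕 φ)) (𝓕 (𝓕 ψ))) := by
      rw [← SchwartzMap.fourier_convolution, FourierTransform.fourierInv_fourier_eq]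
    rw [h2, SchwartzMap.fourierInv_coe, Real.fourierInv_eq_fourier_comp_neg] at h1
    rw [SchwartzMap.fourier_coe]
    have h3 : (fun y => SchwartzMap.pairing (ContinuousLinearMap.mul ℂ ℂ)
        (𝓕 (𝓕 φ)) (𝓕 (𝓕 ψ)) (-y)) =
        ⇑(SchwartzMap.pairing (ContinuousLinearMap.mul ℂ ℂ) φ ψ) := by
      funext y
      simp [h𝓕𝓕]
    rw [h3] at h1
    exact h1
  refine ⟨_, _, hasSpaceTimeFourier_schwartz φ, hasSpaceTimeFourier_schwartz ψ, ?_, ?_⟩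
  · refine Filter.Eventually.of_forall fun η => ?_
    have hi : Integrable (spaceTimeFourier φ) volume := by
      rw [funext (spaceTimeFourier_eq φ)]
      exact ((𝓕 φ).integrable (μ := volume)).comp_smul (inv_ne_zero hpi)
    refine hi.mul_bdd (c := SchwartzMap.seminorm ℝ 0 0 (𝓕 ψ)) ?_ ?_
    · simp only [spaceTimeFourier_eq]
      exact ((𝓕 ψ).continuous.comp (by fun_prop)).aestronglyMeasurable
    · refine Filter.Eventually.of_forall fun y => ?_
      rw [spaceTimeFourier_eq]
      exact SchwartzMap.norm_le_seminorm ℝ _ _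
  · convert hasSpaceTimeFourier_schwartz _ using 1
    funext η
    rw [spaceTimeFourier_eq, hconv]
    have h3 := Measure.integral_comp_smul (volume : Measure Plane)
      (fun y => 𝓕 φ y * 𝓕 ψ ((2 * Real.pi)⁻¹ • η - y)) (2 * Real.pi)⁻¹
    simp only [spaceTimeFourier_eq, smul_sub]
    rw [h3]
    have h4 : |(((2 * Real.pi)⁻¹ ^ Module.finrank ℝ Plane)⁻¹ : ℝ)| = (2 * Real.pi) ^ 2 := by
      rw [finrank_euclideanSpace_fin, inv_pow, inv_inv, abs_of_nonneg (by positivity)]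
    rw [h4, Complex.real_smul]
    push_cast
    have h5 : (2 * (Real.pi : ℂ)) ^ 2 ≠ 0 := by exact_mod_cast pow_ne_zero 2 hpi
    field_simp

end

/-!
The estimate is proved on the Fourier side. Write `σ = |τ| - γ(ξ)` for the modulation of `(τ, ξ)`
and `σ₁`, `σ₂`, `ξ₁`, `ξ₂` for the modulations and frequencies of the two factors, `ξ = ξ₁ + ξ₂`.
The multiplier is bounded by `2⟨ξ⟩⁻¹` (`norm_nonlinearMultiplier_le`), so it suffices to bound the
convolution in the norm with the weight `⟨σ⟩^{-a}⟨ξ⟩^{s-1}`.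

Because `⟨ξ⟩⁻¹` is square integrable, no dispersion is needed when `s ≥ 0`: the weight
`⟨σ₁⟩^{-b}`, `b > 1/2`, puts one factor in `L²_ξ L¹_τ`, the other factor is in `L²`, hence their
convolution is in `L^∞_ξ L²_τ`, and a factor `h(ξ)` with `h ∈ L²` brings it into `L²`
(`lintegral_profile_mul_convolution_sq_le`).

When `-1/2 < s < 0` put `r = -s`; one has to absorb `(⟨ξ₁⟩⟨ξ₂⟩/⟨ξ⟩)^r`. If `ξ₁` and `ξ₂` are
`O(⟨ξ⟩)` this is `O(⟨ξ⟩^r)`, and `⟨ξ⟩^{r-1}` is still square integrable. Otherwise two nearly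
opposite high frequencies produce a low one, and the resonance inequality `resonance_le`,
`|ξ|(ξ₁² + ξ₂²) ≲ |σ| + |σ₁| + |σ₂|`, which rests on `γ` growing like a cube (`dispersion_sub_ge`),
yields a gain `(|ξ|(ξ₁² + ξ₂²))^{-a}` from one of the modulations. Since `r ≤ a`, what remains is
`|ξ|^{-a}`, locally square integrable as `a < 1/2`. If an input modulation is the large one, the
decay of the other input modulation remains for the `L¹_τ` bound. Both cases are
`xWeight_add_le`, with the profile `h(ξ) = ⟨ξ⟩⁻¹(⟨ξ⟩^r + |ξ|^{-a})`.

For the passage to distributions, functions with finite weighted `L²` norm are Fourier transforms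
of tempered distributions (`exists_hasSpaceTimeFourier`), and `X^{s,b}` consists of exactly the
distributions whose transform is such a function (`exists_of_mem_XSpace`,
`mem_XSpace_of_eLpNorm_lt_top`).
-/

/-! ### The weights, the dispersion relation and the resonance inequality -/

theorem one_le_japanese (x : ℝ) : 1 ≤ japanese x := by
  unfold japanese; linarith [abs_nonneg x]

theorem japanese_pos (x : ℝ) : 0 < japanese x := one_pos.trans_le (one_le_japanese x)

theorem japanese_add_le_mul (x y : ℝ) : japanese (x + y) ≤ japanese x * japanese y := by
  unfold japanese
  nlinarith [abs_add_le x y, mul_nonneg (abs_nonneg x) (abs_nonneg y)]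

theorem xWeight_pos (β s b : ℝ) (η : Plane) : 0 < xWeight β s b η :=
  mul_pos (Real.rpow_pos_of_pos (japanese_pos _) _) (Real.rpow_pos_of_pos (japanese_pos _) _)

theorem dispersion_nonneg (β ξ : ℝ) : 0 ≤ dispersion β ξ := Real.sqrt_nonneg _

theorem dispersion_sq {β : ℝ} (hβ : β = 1 ∨ β = -1) (ξ : ℝ) :
    dispersion β ξ ^ 2 = ξ ^ 2 - β * ξ ^ 4 + ξ ^ 6 := by
  refine Real.sq_sqrt ?_
  have h : ξ ^ 2 - β * ξ ^ 4 + ξ ^ 6 = ξ ^ 2 * (1 - β * ξ ^ 2 + (ξ ^ 2) ^ 2) := by ring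
  rw [h]
  refine mul_nonneg (sq_nonneg _) ?_
  rcases hβ with rfl | rfl <;> nlinarith [sq_nonneg (ξ ^ 2 - 1), sq_nonneg (ξ ^ 2 + 1)]

theorem dispersion_le {β : ℝ} (hβ : β = 1 ∨ β = -1) (ξ : ℝ) :
    dispersion β ξ ≤ |ξ| * (1 + ξ ^ 2) := by
  refine abs_le_of_sq_le_sq' ?_ (by positivity) |>.2
  rw [dispersion_sq hβ, mul_pow, sq_abs]
  rcases hβ with rfl | rfl <;> nlinarith [sq_nonneg (ξ ^ 2)]

theorem le_dispersion {β : ℝ} (hβ : β = 1 ∨ β = -1) (ξ : ℝ) :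
    |ξ| * (1 + ξ ^ 2) / 2 ≤ dispersion β ξ := by
  refine abs_le_of_sq_le_sq' ?_ (dispersion_nonneg _ _) |>.2
  rw [dispersion_sq hβ, div_pow, mul_pow, sq_abs]
  rcases hβ with rfl | rfl <;>
    nlinarith [mul_nonneg (sq_nonneg ξ) (sq_nonneg (ξ ^ 2 - 1)), sq_nonneg (ξ ^ 2), sq_nonneg ξ,
      sq_nonneg (ξ ^ 3)]

theorem norm_nonlinearMultiplier_le {β : ℝ} (hβ : β = 1 ∨ β = -1) (η : Plane) :
    ‖nonlinearMultiplier β η‖ ≤ 2 * (japanese (η 1))⁻¹ := by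
  have h0 : ‖nonlinearMultiplier β η‖ = (η 1) ^ 2 / (2 * dispersion β (η 1)) := by
    simp [nonlinearMultiplier, abs_of_nonneg (dispersion_nonneg β (η 1))]
  rw [h0]
  set ξ := η 1
  rcases eq_or_ne ξ 0 with h | h
  · rw [h]
    have := japanese_pos 0
    simp only [ne_eq, OfNat.ofNat_ne_zero, not_false_eq_true, zero_pow, zero_div]
    positivity
  · have hx : 0 < |ξ| := abs_pos.2 h
    have hd := le_dispersion hβ ξ
    have hd0 : 0 < dispersion β ξ := lt_of_lt_of_le (by positivity) hd
    rw [← div_eq_mul_inv, div_le_div_iff₀ (by positivity) (japanese_pos _)]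
    unfold japanese
    rw [← sq_abs] at hd ⊢
    nlinarith [mul_pos hx hx, mul_nonneg hx.le (sq_nonneg (|ξ| - 1)), sq_nonneg (|ξ| - 1)]

/-- Quantitative monotonicity of the dispersion relation at high frequency. -/
theorem dispersion_sub_ge {β : ℝ} (hβ : β = 1 ∨ β = -1) {x y : ℝ} (hy : 0 ≤ y) (hxy : y ≤ x)
    (h1 : 1 ≤ x ^ 2 + y ^ 2) :
    (x - y) * (x ^ 2 + y ^ 2) / 8 ≤ dispersion β x - dispersion β y := by
  have hx : 0 ≤ x := hy.trans hxy
  have hS : dispersion β x + dispersion β y ≤ (x + y) * (2 * (x ^ 2 + y ^ 2)) := by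
    have hX := dispersion_le hβ x
    have hY := dispersion_le hβ y
    rw [abs_of_nonneg hx] at hX
    rw [abs_of_nonneg hy] at hY
    nlinarith [mul_nonneg hx (sq_nonneg y), mul_nonneg hy (sq_nonneg x)]
  have hD : (x ^ 2 - y ^ 2) * (x ^ 2 + y ^ 2) ^ 2 / 4 ≤
      (dispersion β x - dispersion β y) * (dispersion β x + dispersion β y) := by
    have h2 : (dispersion β x - dispersion β y) * (dispersion β x + dispersion β y) =
        (x ^ 2 - y ^ 2) *
          (1 - β * (x ^ 2 + y ^ 2) + ((x ^ 2) ^ 2 + x ^ 2 * y ^ 2 + (y ^ 2) ^ 2)) := by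
      linear_combination dispersion_sq hβ x - dispersion_sq hβ y
    rw [h2, mul_div_assoc]
    refine mul_le_mul_of_nonneg_left ?_ (by nlinarith)
    rcases hβ with rfl | rfl <;>
      nlinarith [sq_nonneg (x ^ 2 - y ^ 2), sq_nonneg (x ^ 2 + y ^ 2 - 1), sq_nonneg (x ^ 2 + y ^ 2)]
  have hm : 0 ≤ dispersion β x - dispersion β y := by
    by_contra! hneg
    have h3 : 0 ≤ (x ^ 2 - y ^ 2) * (x ^ 2 + y ^ 2) ^ 2 / 4 := by
      have : 0 ≤ x ^ 2 - y ^ 2 := by nlinarith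
      positivity
    have h4 : 0 < dispersion β x + dispersion β y := by
      linarith [dispersion_nonneg β x, dispersion_nonneg β y]
    linarith [mul_neg_of_neg_of_pos hneg h4]
  have hx0 : 0 < x + y := by
    by_contra! h
    have h5 : x = 0 := by linarith
    have h6 : y = 0 := by linarith
    norm_num [h5, h6] at h1
  have hq : 0 < x ^ 2 + y ^ 2 := by linarith
  have hfin : (x + y) * (2 * (x ^ 2 + y ^ 2)) * ((x - y) * (x ^ 2 + y ^ 2) / 8) ≤
      (x + y) * (2 * (x ^ 2 + y ^ 2)) * (dispersion β x - dispersion β y) := by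
    calc _ = (x ^ 2 - y ^ 2) * (x ^ 2 + y ^ 2) ^ 2 / 4 := by ring
      _ ≤ _ := hD
      _ ≤ (dispersion β x - dispersion β y) * ((x + y) * (2 * (x ^ 2 + y ^ 2))) :=
        mul_le_mul_of_nonneg_left hS hm
      _ = _ := by ring
  exact le_of_mul_le_mul_left hfin (by positivity)

/-- The resonance inequality: when two high frequencies interact to a much lower one, at least one
of the three modulations `|τ| - γ(ξ)` is large. -/
theorem resonance_le {β : ℝ} (hβ : β = 1 ∨ β = -1) (τ₁ τ₂ ξ₁ ξ₂ : ℝ)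
    (h : 16 * (1 + (ξ₁ + ξ₂) ^ 2) ≤ ξ₁ ^ 2 + ξ₂ ^ 2) :
    |ξ₁ + ξ₂| * (ξ₁ ^ 2 + ξ₂ ^ 2) / 16 ≤
      |(|τ₁ + τ₂|) - dispersion β (ξ₁ + ξ₂)| + |(|τ₁|) - dispersion β ξ₁|
        + |(|τ₂|) - dispersion β ξ₂| := by
  wlog hle : |ξ₂| ≤ |ξ₁| generalizing τ₁ τ₂ ξ₁ ξ₂
  · have := this τ₂ τ₁ ξ₂ ξ₁ (by rw [add_comm ξ₂]; linarith) (le_of_not_ge hle)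
    rw [add_comm ξ₂, add_comm τ₂] at this
    linarith
  have hg : ∀ x, dispersion β |x| = dispersion β x := by
    intro x
    unfold dispersion
    rw [Even.pow_abs (by decide), Even.pow_abs (by decide), Even.pow_abs (by decide)]
  have h1 := dispersion_sub_ge hβ (abs_nonneg ξ₂) hle (by
    rw [sq_abs, sq_abs]; nlinarith [sq_nonneg (ξ₁ + ξ₂)])
  rw [hg, hg, sq_abs, sq_abs] at h1
  have h2 : |ξ₁ + ξ₂| ≤ |ξ₁| - |ξ₂| := by
    have hneg : ξ₁ * ξ₂ ≤ 0 := by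
      by_contra! hpos
      nlinarith
    refine abs_le_of_sq_le_sq' ?_ (by linarith) |>.2
    have h3 : |ξ₁| * |ξ₂| = -(ξ₁ * ξ₂) := by rw [← abs_mul, abs_of_nonpos hneg]
    nlinarith [sq_abs (ξ₁ + ξ₂), sq_abs ξ₁, sq_abs ξ₂]
  have h4 := dispersion_le hβ (ξ₁ + ξ₂)
  have h5 : |τ₁| - |τ₂| ≤ |τ₁ + τ₂| := by
    have := abs_sub_abs_le_abs_sub τ₁ (-τ₂)
    simpa using this
  have h6 : |ξ₁ + ξ₂| * (1 + (ξ₁ + ξ₂) ^ 2) ≤ |ξ₁ + ξ₂| * ((ξ₁ ^ 2 + ξ₂ ^ 2) / 16) :=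
    mul_le_mul_of_nonneg_left (by linarith) (abs_nonneg _)
  have h7 : |ξ₁ + ξ₂| * (ξ₁ ^ 2 + ξ₂ ^ 2) ≤ (|ξ₁| - |ξ₂|) * (ξ₁ ^ 2 + ξ₂ ^ 2) :=
    mul_le_mul_of_nonneg_right h2 (by positivity)
  have h8 := le_abs_self (|τ₁ + τ₂| - dispersion β (ξ₁ + ξ₂))
  have h9 := neg_abs_le (|τ₁| - dispersion β ξ₁)
  have h10 := le_abs_self (|τ₂| - dispersion β ξ₂)
  linarith

/-! ### Pointwise bound for the bilinear multiplier -/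

theorem rpow_japanese_le {a b x : ℝ} (hab : a ≤ b) : japanese x ^ a ≤ japanese x ^ b :=
  Real.rpow_le_rpow_of_exponent_le (one_le_japanese x) hab

/-- The core of the pointwise bound. If `ξ₁, ξ₂` are not much larger than `ξ = ξ₁ + ξ₂`, the first
factor is `O(⟨ξ⟩^r)` and no modulation is needed. Otherwise `⟨ξ₁⟩⟨ξ₂⟩ ≲ ξ₁² + ξ₂²`, and the resonance
inequality trades `(ξ₁² + ξ₂²)^r` for `|ξ|^{-a}` and `a`-th powers of the modulations, which is
possible because `r ≤ a ≤ b`. -/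
theorem japanese_mul_rpow_mul_modulation_le {β : ℝ} (hβ : β = 1 ∨ β = -1) {r a b : ℝ}
    (hr : 0 ≤ r) (hra : r ≤ a) (ha1 : a ≤ 1) (hab : a ≤ b) (τ₁ τ₂ ξ₁ ξ₂ : ℝ)
    (hξ : ξ₁ + ξ₂ ≠ 0) :
    (japanese ξ₁ * japanese ξ₂ / japanese (ξ₁ + ξ₂)) ^ r *
        japanese (|τ₁ + τ₂| - dispersion β (ξ₁ + ξ₂)) ^ (-a) ≤
      64 * (japanese (ξ₁ + ξ₂) ^ r + |ξ₁ + ξ₂| ^ (-a)) *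
        (japanese (|τ₁| - dispersion β ξ₁) ^ b + japanese (|τ₂| - dispersion β ξ₂) ^ b) := by
  have ha0 : 0 ≤ a := hr.trans hra
  have hb0 : 0 ≤ b := ha0.trans hab
  set σ := |τ₁ + τ₂| - dispersion β (ξ₁ + ξ₂)
  set σ₁ := |τ₁| - dispersion β ξ₁ with hσ₁
  set σ₂ := |τ₂| - dispersion β ξ₂ with hσ₂
  set ξ := ξ₁ + ξ₂ with hξdef
  have hJ := one_le_japanese ξ
  have hJ1 := one_le_japanese ξ₁
  have hJ2 := one_le_japanese ξ₂
  have hx : 0 < |ξ| := abs_pos.2 hξ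
  have hσJ := one_le_japanese σ
  have hσJ1 := one_le_japanese σ₁
  have hσJ2 := one_le_japanese σ₂
  have hB1 : 1 ≤ japanese σ₁ ^ b := Real.one_le_rpow hσJ1 hb0
  have hB2 : 1 ≤ japanese σ₂ ^ b := Real.one_le_rpow hσJ2 hb0
  rcases lt_or_ge (ξ₁ ^ 2 + ξ₂ ^ 2) (16 * (1 + ξ ^ 2)) with hnr | hres
  -- Comparable frequencies.
  · have hle : ∀ x : ℝ, x ^ 2 < 16 * (1 + ξ ^ 2) → japanese x ≤ 5 * japanese ξ := by
      intro x hx'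
      have : |x| ≤ 4 * (1 + |ξ|) :=
        (abs_le_of_sq_le_sq' (by nlinarith [sq_abs x, sq_abs ξ, hx]) (by positivity)).2
      unfold japanese
      linarith
    have h1 := hle ξ₁ (by nlinarith [sq_nonneg ξ₂])
    have h2 := hle ξ₂ (by nlinarith [sq_nonneg ξ₁])
    have h3 : japanese ξ₁ * japanese ξ₂ / japanese ξ ≤ 25 * japanese ξ := by
      rw [div_le_iff₀ (by linarith)]
      nlinarith
    have h4 : (japanese ξ₁ * japanese ξ₂ / japanese ξ) ^ r ≤ 25 * japanese ξ ^ r := by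
      refine (Real.rpow_le_rpow (by positivity) h3 hr).trans ?_
      rw [Real.mul_rpow (by norm_num) (by linarith)]
      refine mul_le_mul_of_nonneg_right ?_ (by positivity)
      exact (Real.rpow_le_rpow_of_exponent_le (by norm_num) (hra.trans ha1)).trans
        (Real.rpow_one _).le
    have h5 : japanese σ ^ (-a) ≤ 1 := Real.rpow_le_one_of_one_le_of_nonpos hσJ (by linarith)
    have h6 : 0 < japanese ξ ^ r := Real.rpow_pos_of_pos (by linarith) _
    have h7 : 0 < |ξ| ^ (-a) := Real.rpow_pos_of_pos hx _
    have h8 : 0 < japanese σ ^ (-a) := Real.rpow_pos_of_pos (by linarith) _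
    calc _ ≤ 25 * japanese ξ ^ r * 1 := by gcongr
      _ ≤ 64 * (japanese ξ ^ r + |ξ| ^ (-a)) * 1 := by nlinarith
      _ ≤ _ := by gcongr; linarith
  -- High frequencies interacting to a low one.
  · have hpq : 16 ≤ ξ₁ ^ 2 + ξ₂ ^ 2 := by nlinarith [sq_nonneg ξ]
    have h1 : japanese ξ₁ * japanese ξ₂ / japanese ξ ≤ 4 * (ξ₁ ^ 2 + ξ₂ ^ 2) := by
      refine (div_le_self (by positivity) hJ).trans ?_
      unfold japanese
      nlinarith [sq_abs ξ₁, sq_abs ξ₂, sq_nonneg (|ξ₁| - |ξ₂|), sq_nonneg (|ξ₁| - 1),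
        sq_nonneg (|ξ₂| - 1)]
    have h2 : (japanese ξ₁ * japanese ξ₂ / japanese ξ) ^ r ≤ (4 * (ξ₁ ^ 2 + ξ₂ ^ 2)) ^ a :=
      (Real.rpow_le_rpow (by positivity) h1 hr).trans
        (Real.rpow_le_rpow_of_exponent_le (by linarith) hra)
    -- `|σ| + |σ₁| + |σ₂| ≤ ⟨σ⟩(⟨σ₁⟩ + ⟨σ₂⟩)` keeps the output modulation as a factor, to be
    -- cancelled by the weight `⟨σ⟩^{-a}`.
    have h3 : 4 * (ξ₁ ^ 2 + ξ₂ ^ 2) ≤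
        64 * |ξ|⁻¹ * (japanese σ * (japanese σ₁ + japanese σ₂)) := by
      have hr := resonance_le hβ τ₁ τ₂ ξ₁ ξ₂ hres
      have h4 : |σ| + |σ₁| + |σ₂| ≤ japanese σ * (japanese σ₁ + japanese σ₂) := by
        unfold japanese
        nlinarith [abs_nonneg σ, abs_nonneg σ₁, abs_nonneg σ₂,
          mul_nonneg (abs_nonneg σ) (abs_nonneg σ₁), mul_nonneg (abs_nonneg σ) (abs_nonneg σ₂)]
      have h5 := hr.trans h4
      calc 4 * (ξ₁ ^ 2 + ξ₂ ^ 2) = 64 * |ξ|⁻¹ * (|ξ| * (ξ₁ ^ 2 + ξ₂ ^ 2) / 16) := by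
            field_simp; norm_num
        _ ≤ _ := mul_le_mul_of_nonneg_left h5 (by positivity)
    have h6 : (4 * (ξ₁ ^ 2 + ξ₂ ^ 2)) ^ a ≤
        64 * |ξ| ^ (-a) * (japanese σ ^ a * (japanese σ₁ ^ b + japanese σ₂ ^ b)) := by
      refine (Real.rpow_le_rpow (by positivity) h3 ha0).trans ?_
      rw [Real.mul_rpow (by positivity) (by positivity), Real.mul_rpow (by positivity)
        (by positivity), Real.mul_rpow (by positivity) (by positivity), Real.inv_rpow hx.le,
        ← Real.rpow_neg hx.le]
      have h7 : (64 : ℝ) ^ a ≤ 64 :=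
        (Real.rpow_le_rpow_of_exponent_le (by norm_num) ha1).trans (Real.rpow_one _).le
      have h8 : (japanese σ₁ + japanese σ₂) ^ a ≤ japanese σ₁ ^ b + japanese σ₂ ^ b :=
        (Real.rpow_add_le_add_rpow (by linarith) (by linarith) ha0 ha1).trans
          (add_le_add (rpow_japanese_le hab) (rpow_japanese_le hab))
      gcongr
    have h9 : 0 < japanese σ ^ (-a) := Real.rpow_pos_of_pos (by linarith) _
    have h10 : japanese σ ^ a * japanese σ ^ (-a) = 1 := by
      rw [← Real.rpow_add (by linarith), add_neg_cancel, Real.rpow_zero]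
    calc _ ≤ 64 * |ξ| ^ (-a) * (japanese σ ^ a * (japanese σ₁ ^ b + japanese σ₂ ^ b)) *
          japanese σ ^ (-a) := by gcongr; exact h2.trans h6
      _ = 64 * |ξ| ^ (-a) * (japanese σ₁ ^ b + japanese σ₂ ^ b) *
          (japanese σ ^ a * japanese σ ^ (-a)) := by ring
      _ = 64 * |ξ| ^ (-a) * (japanese σ₁ ^ b + japanese σ₂ ^ b) := by rw [h10, mul_one]
      _ ≤ _ := by
        gcongr
        have : 0 ≤ japanese ξ ^ r := by positivity
        linarith

/-- The frequency profile `⟨ξ⟩^{-1}(⟨ξ⟩^r + |ξ|^{-a})`. It is square integrable when `r < 1/2` and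
`0 ≤ a < 1/2`. At `ξ = 0` the second term has the junk value of `0 ^ (-a)`. -/
noncomputable def frequencyProfile (r a ξ : ℝ) : ℝ := (japanese ξ)⁻¹ * (japanese ξ ^ r + |ξ| ^ (-a))

theorem frequencyProfile_nonneg (r a ξ : ℝ) : 0 ≤ frequencyProfile r a ξ := by
  have := japanese_pos ξ
  unfold frequencyProfile; positivity

/-- Peetre-type inequality covering both signs of `s`: nothing is lost for `s ≥ 0`, and for `s < 0`
it is an equality with the exponent `-s`. -/
theorem rpow_japanese_add_le {s : ℝ} (x y : ℝ) :
    japanese (x + y) ^ s ≤ (japanese x * japanese y / japanese (x + y)) ^ (max (-s) 0) *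
      (japanese x ^ s * japanese y ^ s) := by
  have hx := japanese_pos x
  have hy := japanese_pos y
  have hxy := japanese_pos (x + y)
  rw [← Real.mul_rpow hx.le hy.le]
  rcases le_total 0 s with hs | hs
  · rw [max_eq_right (by linarith), Real.rpow_zero, one_mul]
    exact Real.rpow_le_rpow hxy.le (japanese_add_le_mul x y) hs
  · rw [max_eq_left (by linarith), Real.div_rpow (by positivity) hxy.le, Real.rpow_neg hxy.le,
      Real.rpow_neg (by positivity)]
    have : 0 < (japanese x * japanese y) ^ s := by positivity
    have : 0 < japanese (x + y) ^ s := by positivity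
    apply le_of_eq
    field_simp

/-- Pointwise bound for the multiplier of the bilinear form: up to a profile depending only on the
output frequency, it is dominated by the decay in the modulation of a single input. -/
theorem xWeight_add_le {β : ℝ} (hβ : β = 1 ∨ β = -1) {s a b : ℝ} (ha : 0 ≤ a)
    (hsa : -s ≤ a) (ha1 : a ≤ 1) (hab : a ≤ b) (η η' : Plane) (hη : (η + η') 1 ≠ 0) :
    xWeight β (s - 1) (-a) (η + η') ≤
      64 * frequencyProfile (max (-s) 0) a ((η + η') 1) *
        (japanese (|η 0| - dispersion β (η 1)) ^ (-b) +
          japanese (|η' 0| - dispersion β (η' 1)) ^ (-b)) *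
        (xWeight β s b η * xWeight β s b η') := by
  have h1 := japanese_mul_rpow_mul_modulation_le hβ (le_max_right (-s) 0) (max_le hsa ha) ha1 hab
    (η 0) (η' 0) (η 1) (η' 1) hη
  have h2 := rpow_japanese_add_le (s := s) (η 1) (η' 1)
  have hη0 : (η + η') 0 = η 0 + η' 0 := rfl
  have hη1 : (η + η') 1 = η 1 + η' 1 := rfl
  unfold xWeight frequencyProfile
  rw [hη0, hη1]
  have hJ := japanese_pos (η 1 + η' 1)
  have hJ1 := japanese_pos (η 1)
  have hJ2 := japanese_pos (η' 1)
  have hS := japanese_pos (|η 0 + η' 0| - dispersion β (η 1 + η' 1))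
  have hS1 := japanese_pos (|η 0| - dispersion β (η 1))
  have hS2 := japanese_pos (|η' 0| - dispersion β (η' 1))
  rw [Real.rpow_sub_one hJ.ne', Real.rpow_neg hS1.le, Real.rpow_neg hS2.le]
  generalize japanese (|η 0 + η' 0| - dispersion β (η 1 + η' 1)) = S at *
  generalize japanese (|η 0| - dispersion β (η 1)) = S₁ at *
  generalize japanese (|η' 0| - dispersion β (η' 1)) = S₂ at *
  generalize max (-s) 0 = r at *
  calc S ^ (-a) * (japanese (η 1 + η' 1) ^ s / japanese (η 1 + η' 1))
      ≤ S ^ (-a) * ((japanese (η 1) * japanese (η' 1) / japanese (η 1 + η' 1)) ^ r *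
        (japanese (η 1) ^ s * japanese (η' 1) ^ s) / japanese (η 1 + η' 1)) := by gcongr
    _ = (japanese (η 1) * japanese (η' 1) / japanese (η 1 + η' 1)) ^ r * S ^ (-a) *
        ((japanese (η 1) ^ s * japanese (η' 1) ^ s) * (japanese (η 1 + η' 1))⁻¹) := by ring
    _ ≤ _ := mul_le_mul_of_nonneg_right h1 (by positivity)
    _ = _ := by
      have : 0 < S₁ ^ b := by positivity
      have : 0 < S₂ ^ b := by positivity
      field_simp
      ring

/-! ### Minkowski's inequality and the convolution in `L^∞_ξ L²_τ` -/

/-- The Cauchy–Schwarz inequality. -/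
theorem sq_lintegral_mul_le {α : Type*} [MeasurableSpace α] (μ : Measure α) {f g : α → ℝ≥0∞}
    (hf : AEMeasurable f μ) (hg : AEMeasurable g μ) :
    (∫⁻ x, f x * g x ∂μ) ^ 2 ≤ (∫⁻ x, f x ^ 2 ∂μ) * ∫⁻ x, g x ^ 2 ∂μ := by
  have h := ENNReal.lintegral_mul_le_Lp_mul_Lq μ Real.HolderConjugate.two_two hf hg
  calc (∫⁻ x, f x * g x ∂μ) ^ 2
      ≤ ((∫⁻ x, f x ^ (2 : ℝ) ∂μ) ^ (1 / 2 : ℝ) * (∫⁻ x, g x ^ (2 : ℝ) ∂μ) ^ (1 / 2 : ℝ)) ^ 2 := by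
        gcongr; exact h
    _ = _ := by
      rw [mul_pow, ← ENNReal.rpow_natCast, ← ENNReal.rpow_natCast, ← ENNReal.rpow_mul,
        ← ENNReal.rpow_mul]
      norm_num

theorem ENNReal.sq_rpow_half (x : ℝ≥0∞) : (x ^ (1 / 2 : ℝ)) ^ 2 = x := by
  rw [← ENNReal.rpow_natCast, ← ENNReal.rpow_mul]
  norm_num

theorem sq_lintegral_sqrt_mul_sqrt_le {α : Type*} [MeasurableSpace α] (μ : Measure α)
    {f g : α → ℝ≥0∞} (hf : AEMeasurable f μ) (hg : AEMeasurable g μ) :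
    (∫⁻ x, f x ^ (1 / 2 : ℝ) * g x ^ (1 / 2 : ℝ) ∂μ) ^ 2 ≤ (∫⁻ x, f x ∂μ) * ∫⁻ x, g x ∂μ := by
  simpa only [ENNReal.sq_rpow_half] using
    sq_lintegral_mul_le μ (hf.pow_const (1 / 2 : ℝ)) (hg.pow_const (1 / 2 : ℝ))

/-- Minkowski's integral inequality in `L²`. -/
theorem lintegral_sq_lintegral_le {α γ : Type*} [MeasurableSpace α] [MeasurableSpace γ]
    (μ : Measure α) (ν : Measure γ) [SFinite μ] [SFinite ν] {A : α → γ → ℝ≥0∞}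
    (hA : Measurable (Function.uncurry A)) :
    ∫⁻ x, (∫⁻ y, A x y ∂ν) ^ 2 ∂μ ≤ (∫⁻ y, (∫⁻ x, A x y ^ 2 ∂μ) ^ (1 / 2 : ℝ) ∂ν) ^ 2 := by
  have hAx : ∀ x, Measurable (A x) := fun x => hA.of_uncurry_left
  have hAy : ∀ y, Measurable (fun x => A x y) := fun y => hA.of_uncurry_right
  have hN : Measurable fun y => (∫⁻ x, A x y ^ 2 ∂μ) ^ (1 / 2 : ℝ) :=
    (Measurable.lintegral_prod_left (hA.pow_const 2)).pow_const _
  set N : γ → ℝ≥0∞ := fun y => (∫⁻ x, A x y ^ 2 ∂μ) ^ (1 / 2 : ℝ) with hNdef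
  have hsq : ∀ f : γ → ℝ≥0∞, Measurable f →
      (∫⁻ y, f y ∂ν) ^ 2 = ∫⁻ y, ∫⁻ z, f y * f z ∂ν ∂ν := by
    intro f hf
    simp_rw [lintegral_const_mul _ hf]
    rw [lintegral_mul_const _ hf, sq]
  have hpair : ∀ y z, ∫⁻ x, A x y * A x z ∂μ ≤ N y * N z := by
    intro y z
    have := sq_lintegral_mul_le μ (hAy y).aemeasurable (hAy z).aemeasurable
    refine (ENNReal.pow_le_pow_left_iff two_ne_zero).1 (this.trans_eq ?_)
    rw [mul_pow, hNdef]
    simp only [ENNReal.sq_rpow_half]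
  rw [hsq N hN]
  simp_rw [fun x => hsq (A x) (hAx x)]
  have hm1 : Measurable fun q : (α × γ) × γ => A q.1.1 q.1.2 * A q.1.1 q.2 :=
    (hA.comp measurable_fst).mul (hA.comp ((measurable_fst.comp measurable_fst).prodMk
      measurable_snd))
  rw [lintegral_lintegral_swap (hm1.lintegral_prod_right').aemeasurable]
  refine lintegral_mono fun y => ?_
  rw [lintegral_lintegral_swap]
  · exact lintegral_mono fun z => hpair y z
  · exact (((hAy y).comp measurable_fst).mul hA).aemeasurable

/-- For a fixed output frequency `ξ`, the convolution is bounded in `L²_τ`: decay of `k` in `τ` puts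
`k F` in `L²_ξ L¹_τ`, so that Young's inequality in `τ` and the Cauchy–Schwarz inequality in `ξ`
apply. -/
theorem lintegral_sq_convolution_le {K : ℝ≥0∞} {k F G : ℝ × ℝ → ℝ≥0∞} (hk : Measurable k)
    (hF : Measurable F) (hG : Measurable G) (hK : ∀ ξ, ∫⁻ τ, k (τ, ξ) ^ 2 ≤ K) (ξ : ℝ) :
    ∫⁻ τ, (∫⁻ p, k p * F p * G ((τ, ξ) - p)) ^ 2 ≤ K * ((∫⁻ p, F p ^ 2) * ∫⁻ p, G p ^ 2) := by
  set A : ℝ → ℝ → ℝ≥0∞ := fun τ ξ' => ∫⁻ τ', k (τ', ξ') * F (τ', ξ') * G (τ - τ', ξ - ξ') with hA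
  set X : ℝ → ℝ≥0∞ := fun ξ' => ∫⁻ τ, F (τ, ξ') ^ 2 with hX
  set Y : ℝ → ℝ≥0∞ := fun ξ' => ∫⁻ τ, G (τ, ξ') ^ 2 with hY
  have hXm : Measurable X := Measurable.lintegral_prod_left' (hF.pow_const 2)
  have hYm : Measurable Y := Measurable.lintegral_prod_left' (hG.pow_const 2)
  have hAm : Measurable (Function.uncurry A) := by
    apply Measurable.lintegral_prod_right'
      (f := fun q : (ℝ × ℝ) × ℝ => k (q.2, q.1.2) * F (q.2, q.1.2) * G (q.1.1 - q.2, ξ - q.1.2))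
    fun_prop
  have h1 : ∀ τ, ∫⁻ p, k p * F p * G ((τ, ξ) - p) = ∫⁻ ξ', A τ ξ' := by
    intro τ
    rw [Measure.volume_eq_prod, lintegral_prod_symm]
    · rfl
    · exact Measurable.aemeasurable (by fun_prop)
  have h2 : ∀ τ ξ', A τ ξ' ^ 2 ≤ K * ∫⁻ τ', F (τ', ξ') ^ 2 * G (τ - τ', ξ - ξ') ^ 2 := by
    intro τ ξ'
    have := sq_lintegral_mul_le volume (f := fun τ' => k (τ', ξ'))
      (g := fun τ' => F (τ', ξ') * G (τ - τ', ξ - ξ')) (by fun_prop) (by fun_prop)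
    simp only [mul_pow, ← mul_assoc] at this
    exact this.trans (mul_le_mul_left (hK ξ') _)
  have h3 : ∀ ξ', ∫⁻ τ, A τ ξ' ^ 2 ≤ K * (X ξ' * Y (ξ - ξ')) := by
    intro ξ'
    refine (lintegral_mono fun τ => h2 τ ξ').trans ?_
    rw [lintegral_const_mul]
    swap
    · apply Measurable.lintegral_prod_right'
        (f := fun q : ℝ × ℝ => F (q.2, ξ') ^ 2 * G (q.1 - q.2, ξ - ξ') ^ 2)
      fun_prop
    refine mul_le_mul_right (le_of_eq ?_) _
    rw [lintegral_lintegral_swap (by fun_prop)]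
    have h4 : ∀ τ', ∫⁻ τ, F (τ', ξ') ^ 2 * G (τ - τ', ξ - ξ') ^ 2 = F (τ', ξ') ^ 2 * Y (ξ - ξ') := by
      intro τ'
      rw [lintegral_const_mul _ (by fun_prop),
        lintegral_sub_right_eq_self (fun τ => G (τ, ξ - ξ') ^ 2) τ']
    simp_rw [h4]
    rw [lintegral_mul_const _ (by fun_prop)]
  calc ∫⁻ τ, (∫⁻ p, k p * F p * G ((τ, ξ) - p)) ^ 2 = ∫⁻ τ, (∫⁻ ξ', A τ ξ') ^ 2 := by
        simp_rw [h1]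
    _ ≤ (∫⁻ ξ', (∫⁻ τ, A τ ξ' ^ 2) ^ (1 / 2 : ℝ)) ^ 2 := lintegral_sq_lintegral_le _ _ hAm
    _ ≤ (∫⁻ ξ', (K * X ξ') ^ (1 / 2 : ℝ) * Y (ξ - ξ') ^ (1 / 2 : ℝ)) ^ 2 := by
        gcongr with ξ'
        rw [← ENNReal.mul_rpow_of_nonneg _ _ (by norm_num), mul_assoc]
        gcongr
        exact h3 ξ'
    _ ≤ (∫⁻ ξ', K * X ξ') * ∫⁻ ξ', Y (ξ - ξ') :=
        sq_lintegral_sqrt_mul_sqrt_le _ (by fun_prop) (by fun_prop)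
    _ = _ := by
        rw [lintegral_const_mul _ hXm, lintegral_sub_left_eq_self Y ξ, mul_assoc,
          Measure.volume_eq_prod, lintegral_prod_symm _ (by fun_prop),
          lintegral_prod_symm _ (by fun_prop)]

/-- The coordinates `(τ, ξ)` of a point of the plane. -/
noncomputable def planeCoordinates : Plane ≃ᵐ ℝ × ℝ :=
  (MeasurableEquiv.toLp 2 (Fin 2 → ℝ)).symm.trans MeasurableEquiv.finTwoArrow

theorem planeCoordinates_apply (η : Plane) : planeCoordinates η = (η 0, η 1) := rfl

theorem measurePreserving_planeCoordinates : MeasurePreserving planeCoordinates :=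
  (EuclideanSpace.volume_preserving_symm_measurableEquiv_toLp (Fin 2)).trans
    (volume_preserving_finTwoArrow ℝ)

theorem planeCoordinates_symm_sub (p q : ℝ × ℝ) :
    planeCoordinates.symm (p - q) = planeCoordinates.symm p - planeCoordinates.symm q := by
  apply planeCoordinates.injective
  rw [MeasurableEquiv.apply_symm_apply, planeCoordinates_apply]
  have h : ∀ r, planeCoordinates (planeCoordinates.symm r) = r := fun r =>
    planeCoordinates.apply_symm_apply r
  simp only [planeCoordinates_apply, Prod.ext_iff] at h
  ext <;> simp [h]

theorem lintegral_plane (f : Plane → ℝ≥0∞) :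
    ∫⁻ η, f η = ∫⁻ p, f (planeCoordinates.symm p) := by
  rw [← (measurePreserving_planeCoordinates.symm _).lintegral_comp_emb
    planeCoordinates.symm.measurableEmbedding]

theorem lintegral_profile_mul_convolution_sq_le {K : ℝ≥0∞} {h : ℝ → ℝ≥0∞} {k F G : Plane → ℝ≥0∞}
    (hh : Measurable h) (hk : Measurable k) (hF : Measurable F) (hG : Measurable G)
    (hK : ∀ ξ, ∫⁻ τ, k (planeCoordinates.symm (τ, ξ)) ^ 2 ≤ K) :
    ∫⁻ η, (h (η 1) * ∫⁻ η', k η' * F η' * G (η - η')) ^ 2 ≤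
      (∫⁻ ξ, h ξ ^ 2) * (K * ((∫⁻ η, F η ^ 2) * ∫⁻ η, G η ^ 2)) := by
  simp only [lintegral_plane]
  have h1 : ∀ p, (planeCoordinates.symm p) 1 = p.2 := fun p =>
    congrArg Prod.snd (planeCoordinates.apply_symm_apply p)
  simp only [h1, ← planeCoordinates_symm_sub]
  have hs := planeCoordinates.symm.measurable
  have hkc := hk.comp hs
  have hFc := hF.comp hs
  have hGc := hG.comp hs
  have hm : Measurable fun p : ℝ × ℝ => ∫⁻ q : ℝ × ℝ, k (planeCoordinates.symm q) *
      F (planeCoordinates.symm q) * G (planeCoordinates.symm (p - q)) := by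
    apply Measurable.lintegral_prod_right' (f := fun q : (ℝ × ℝ) × (ℝ × ℝ) =>
      k (planeCoordinates.symm q.2) * F (planeCoordinates.symm q.2) *
        G (planeCoordinates.symm (q.1 - q.2)))
    fun_prop
  rw [Measure.volume_eq_prod, lintegral_prod_symm _ (by fun_prop), ← lintegral_mul_const _
    (by fun_prop)]
  refine lintegral_mono fun ξ => ?_
  simp only [mul_pow]
  rw [lintegral_const_mul _ (by fun_prop)]
  refine mul_le_mul_right ?_ _
  exact lintegral_sq_convolution_le hkc hFc hGc hK ξ

/-! ### The bilinear estimate for nonnegative functions -/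

theorem continuous_japanese : Continuous japanese := by unfold japanese; fun_prop

theorem continuous_dispersion (β : ℝ) : Continuous (dispersion β) := by
  unfold dispersion; fun_prop

theorem continuous_rpow_japanese (b : ℝ) : Continuous fun x => japanese x ^ b :=
  continuous_japanese.rpow_const fun x => Or.inl (japanese_pos x).ne'

theorem continuous_xWeight (β s b : ℝ) : Continuous (xWeight β s b) := by
  have h0 : Continuous fun η : Plane => η 0 := by fun_prop
  have h1 : Continuous fun η : Plane => η 1 := by fun_prop
  exact ((continuous_rpow_japanese b).comp (h0.abs.sub ((continuous_dispersion β).comp h1))).mul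
    ((continuous_rpow_japanese s).comp h1)

theorem lintegral_rpow_japanese_lt_top {r : ℝ} (hr : 1 < r) :
    ∫⁻ x : ℝ, ENNReal.ofReal (japanese x ^ (-r)) < ∞ := by
  have := finite_integral_one_add_norm (E := ℝ) (μ := volume) (r := r) (by simpa using hr)
  simpa only [japanese, Real.norm_eq_abs] using this

/-- The modulation weight is square integrable in `τ`, uniformly in the frequency. -/
theorem exists_lintegral_modulation_sq_le {b : ℝ} (hb : 1 / 2 < b) :
    ∃ K : ℝ≥0∞, K < ∞ ∧ ∀ m : ℝ,
      ∫⁻ τ : ℝ, ENNReal.ofReal (japanese (|τ| - m) ^ (-b)) ^ 2 ≤ K := by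
  set I := ∫⁻ x : ℝ, ENNReal.ofReal (japanese x ^ (-(2 * b))) with hI
  have hIt : I < ∞ := lintegral_rpow_japanese_lt_top (by linarith)
  refine ⟨I + I, ENNReal.add_lt_top.2 ⟨hIt, hIt⟩, fun m => ?_⟩
  have hp : ∀ τ : ℝ, ENNReal.ofReal (japanese (|τ| - m) ^ (-b)) ^ 2 ≤
      ENNReal.ofReal (japanese (τ - m) ^ (-(2 * b))) +
        ENNReal.ofReal (japanese (τ + m) ^ (-(2 * b))) := by
    intro τ
    have h1 : ENNReal.ofReal (japanese (|τ| - m) ^ (-b)) ^ 2 =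
        ENNReal.ofReal (japanese (|τ| - m) ^ (-(2 * b))) := by
      rw [← ENNReal.ofReal_pow (by have := japanese_pos (|τ| - m); positivity),
        ← Real.rpow_mul_natCast (japanese_pos _).le]
      congr 2
      push_cast
      ring
    rw [h1]
    rcases abs_cases τ with ⟨h, _⟩ | ⟨h, _⟩
    · rw [h]; exact le_self_add
    · have h2 : japanese (|τ| - m) = japanese (τ + m) := by
        unfold japanese
        rw [h, ← abs_neg]
        congr 2
        ring
      rw [h2]; exact le_add_self
  have hm : Measurable fun x : ℝ => ENNReal.ofReal (japanese x ^ (-(2 * b))) :=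
    (continuous_rpow_japanese _).measurable.ennreal_ofReal
  have hm' : Measurable fun x : ℝ => ENNReal.ofReal (japanese (x - m) ^ (-(2 * b))) :=
    hm.comp (measurable_id.sub_const m)
  calc _ ≤ ∫⁻ τ : ℝ, (ENNReal.ofReal (japanese (τ - m) ^ (-(2 * b))) +
        ENNReal.ofReal (japanese (τ + m) ^ (-(2 * b)))) := lintegral_mono hp
    _ = I + I := by
      rw [lintegral_add_left hm',
        lintegral_sub_right_eq_self (fun x : ℝ => ENNReal.ofReal (japanese x ^ (-(2 * b)))) m,
        lintegral_add_right_eq_self (fun x : ℝ => ENNReal.ofReal (japanese x ^ (-(2 * b)))) m]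

theorem measurable_frequencyProfile (r a : ℝ) : Measurable (frequencyProfile r a) := by
  have h1 := continuous_japanese.measurable
  have h2 := (continuous_rpow_japanese r).measurable
  unfold frequencyProfile
  fun_prop

theorem lintegral_frequencyProfile_sq_lt_top {r a : ℝ} (hr : r < 1 / 2) (ha : 0 ≤ a)
    (ha' : a < 1 / 2) : ∫⁻ ξ : ℝ, ENNReal.ofReal (frequencyProfile r a ξ) ^ 2 < ∞ := by
  set g : ℝ → ℝ := fun ξ => Set.indicator (Set.Ioc (-1) 1) (fun ξ => |ξ| ^ (-(2 * a))) ξ with hg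
  have hlocal : ∫⁻ ξ : ℝ, ENNReal.ofReal (g ξ) < ∞ := by
    have h1 : IntervalIntegrable (fun x : ℝ => |x| ^ (-(2 * a))) volume 0 1 := by
      refine (intervalIntegral.intervalIntegrable_rpow' (by linarith : -1 < -(2 * a))).congr ?_
      intro x hx
      rw [Set.uIoc_of_le zero_le_one] at hx
      simp only [abs_of_pos hx.1]
    have h2 : IntervalIntegrable (fun x : ℝ => |x| ^ (-(2 * a))) volume (-1) 0 := by
      have := (IntervalIntegrable.iff_comp_neg (a := 0) (b := 1)).1 h1
      simpa using this.symm
    have h3 := (intervalIntegrable_iff_integrableOn_Ioc_of_le (by norm_num)).1 (h2.trans h1)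
    have h4 : Integrable g volume := (integrable_indicator_iff measurableSet_Ioc).2 h3
    exact h4.lintegral_lt_top
  have hp : ∀ ξ : ℝ, ENNReal.ofReal (frequencyProfile r a ξ) ^ 2 ≤
      2 * (ENNReal.ofReal (japanese ξ ^ (-(2 - 2 * r))) + (ENNReal.ofReal (japanese ξ ^ (-2 : ℝ)) +
        ENNReal.ofReal (g ξ))) := by
    intro ξ
    have hJ := japanese_pos ξ
    have hJ1 := one_le_japanese ξ
    have hg0 : 0 ≤ g ξ := Set.indicator_nonneg (fun x _ => by positivity) ξ
    rw [← ENNReal.ofReal_pow (frequencyProfile_nonneg _ _ _), ← ENNReal.ofReal_add (by positivity)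
      hg0, ← ENNReal.ofReal_add (by positivity) (by positivity), ← ENNReal.ofReal_ofNat 2,
      ← ENNReal.ofReal_mul (by norm_num)]
    apply ENNReal.ofReal_le_ofReal
    have h1 : ((japanese ξ)⁻¹ * japanese ξ ^ r) ^ 2 = japanese ξ ^ (-(2 - 2 * r)) := by
      rw [← Real.rpow_neg_one, ← Real.rpow_add hJ, ← Real.rpow_mul_natCast hJ.le]
      congr 1
      push_cast
      ring
    have h2 : ((japanese ξ)⁻¹ * |ξ| ^ (-a)) ^ 2 ≤ japanese ξ ^ (-2 : ℝ) + g ξ := by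
      by_cases hξ : ξ ∈ Set.Ioc (-1 : ℝ) 1
      · have h3 : g ξ = (|ξ| ^ (-a)) ^ 2 := by
          simp only [hg, Set.indicator_of_mem hξ]
          rw [← Real.rpow_mul_natCast (abs_nonneg ξ)]
          congr 1
          push_cast
          ring
        rw [h3, mul_pow]
        have h4 : ((japanese ξ)⁻¹) ^ 2 ≤ 1 := pow_le_one₀ (by positivity) (inv_le_one_of_one_le₀ hJ1)
        have h5 : 0 ≤ japanese ξ ^ (-2 : ℝ) := by positivity
        nlinarith [sq_nonneg (|ξ| ^ (-a))]
      · have h3 : 1 ≤ |ξ| := by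
          by_contra! h
          exact hξ ⟨(abs_lt.1 h).1, (abs_lt.1 h).2.le⟩
        have h4 : |ξ| ^ (-a) ≤ 1 := Real.rpow_le_one_of_one_le_of_nonpos h3 (by linarith)
        have h5 : ((japanese ξ)⁻¹) ^ 2 = japanese ξ ^ (-2 : ℝ) := by
          rw [inv_pow, Real.rpow_neg hJ.le, Real.rpow_two]
        rw [mul_pow, h5]
        have h6 : (|ξ| ^ (-a)) ^ 2 ≤ 1 := pow_le_one₀ (by positivity) h4
        have h7 : 0 ≤ japanese ξ ^ (-2 : ℝ) := by positivity
        nlinarith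
    unfold frequencyProfile
    rw [mul_add]
    nlinarith [sq_nonneg ((japanese ξ)⁻¹ * japanese ξ ^ r - (japanese ξ)⁻¹ * |ξ| ^ (-a))]
  refine (lintegral_mono hp).trans_lt ?_
  have hm := fun r => ((continuous_rpow_japanese r).measurable.ennreal_ofReal)
  rw [lintegral_const_mul' _ _ (by norm_num), lintegral_add_left (hm _), lintegral_add_left (hm _)]
  refine ENNReal.mul_lt_top (by norm_num) (ENNReal.add_lt_top.2 ⟨?_, ENNReal.add_lt_top.2
    ⟨?_, hlocal⟩⟩)
  · exact lintegral_rpow_japanese_lt_top (by linarith)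
  · exact lintegral_rpow_japanese_lt_top (by norm_num)

theorem ae_frequency_ne_zero : ∀ᵐ η : Plane, η 1 ≠ 0 := by
  have h : ∀ᵐ p : ℝ × ℝ, p.2 ≠ 0 :=
    Measure.quasiMeasurePreserving_snd.ae (p := fun x : ℝ => x ≠ 0) (by simp [ae_iff])
  exact measurePreserving_planeCoordinates.quasiMeasurePreserving.ae h

theorem ENNReal.add_sq_le_two_mul (x y : ℝ≥0∞) : (x + y) ^ 2 ≤ 2 * (x ^ 2 + y ^ 2) := by
  have h := ENNReal.rpow_add_le_mul_rpow_add_rpow x y (p := 2) (by norm_num)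
  norm_num at h
  exact h

/-- The bilinear estimate on the Fourier side. The pointwise bound gives two convolutions, with the
decaying weight on one or the other factor; they are exchanged by `η' ↦ η - η'`. -/
theorem exists_lintegral_convolution_le {s a b : ℝ} (hb : 1 / 2 < b) (ha : 0 ≤ a)
    (ha' : a < 1 / 2) (hsa : -s ≤ a) :
    ∃ C : ℝ≥0∞, C < ∞ ∧ ∀ β : ℝ, (β = 1 ∨ β = -1) → ∀ f g : Plane → ℝ≥0∞, Measurable f →
      Measurable g →
      ∫⁻ η, (ENNReal.ofReal (xWeight β (s - 1) (-a) η) * ∫⁻ η', f η' * g (η - η')) ^ 2 ≤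
        C * ((∫⁻ η, (ENNReal.ofReal (xWeight β s b η) * f η) ^ 2) *
          ∫⁻ η, (ENNReal.ofReal (xWeight β s b η) * g η) ^ 2) := by
  obtain ⟨K, hKt, hK⟩ := exists_lintegral_modulation_sq_le hb
  set h : ℝ → ℝ≥0∞ := fun ξ => 64 * ENNReal.ofReal (frequencyProfile (max (-s) 0) a ξ) with hh
  have hhm : Measurable h := (measurable_frequencyProfile _ _).ennreal_ofReal.const_mul _
  have hht : ∫⁻ ξ, h ξ ^ 2 < ∞ := by
    simp only [hh, mul_pow]
    rw [lintegral_const_mul' _ _ (by norm_num)]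
    exact ENNReal.mul_lt_top (by norm_num) (lintegral_frequencyProfile_sq_lt_top
      (max_lt (by linarith) (by norm_num)) ha ha')
  refine ⟨4 * ((∫⁻ ξ, h ξ ^ 2) * K), ENNReal.mul_lt_top (by norm_num)
    (ENNReal.mul_lt_top hht hKt), fun β hβ f g hf hg => ?_⟩
  have hWm : Measurable fun η : Plane => ENNReal.ofReal (xWeight β s b η) :=
    (continuous_xWeight β s b).measurable.ennreal_ofReal
  set F : Plane → ℝ≥0∞ := fun η => ENNReal.ofReal (xWeight β s b η) * f η with hF
  set G : Plane → ℝ≥0∞ := fun η => ENNReal.ofReal (xWeight β s b η) * g η with hG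
  have hFm : Measurable F := hWm.mul hf
  have hGm : Measurable G := hWm.mul hg
  set k : Plane → ℝ≥0∞ := fun η =>
    ENNReal.ofReal (japanese (|η 0| - dispersion β (η 1)) ^ (-b)) with hk
  have hkm : Measurable k := by
    have h0 : Continuous fun η : Plane => η 0 := by fun_prop
    have h1 : Continuous fun η : Plane => η 1 := by fun_prop
    exact ((continuous_rpow_japanese (-b)).comp
      (h0.abs.sub ((continuous_dispersion β).comp h1))).measurable.ennreal_ofReal
  have hkK : ∀ ξ, ∫⁻ τ, k (planeCoordinates.symm (τ, ξ)) ^ 2 ≤ K := by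
    intro ξ
    have h0 : ∀ p, (planeCoordinates.symm p) 0 = p.1 := fun p =>
      congrArg Prod.fst (planeCoordinates.apply_symm_apply p)
    have h1 : ∀ p, (planeCoordinates.symm p) 1 = p.2 := fun p =>
      congrArg Prod.snd (planeCoordinates.apply_symm_apply p)
    simp only [hk, h0, h1]
    exact hK _
  have hpt : ∀ η : Plane, η 1 ≠ 0 →
      ENNReal.ofReal (xWeight β (s - 1) (-a) η) * ∫⁻ η', f η' * g (η - η') ≤
        h (η 1) * (∫⁻ η', k η' * F η' * G (η - η')) +
          h (η 1) * (∫⁻ η', k η' * G η' * F (η - η')) := by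
    intro η hη
    have hswap : ∫⁻ η', k η' * G η' * F (η - η') = ∫⁻ η', k (η - η') * F η' * G (η - η') := by
      rw [← lintegral_sub_left_eq_self (fun η' => k η' * G η' * F (η - η')) η]
      refine lintegral_congr fun η' => ?_
      rw [sub_sub_cancel]
      ring
    rw [hswap, ← mul_add, ← lintegral_add_left (by fun_prop),
      ← lintegral_const_mul _ (by fun_prop), ← lintegral_const_mul _ (by fun_prop)]
    refine lintegral_mono fun η' => ?_
    have key := xWeight_add_le hβ (s := s) (b := b) ha hsa (by linarith) (by linarith) η' (η - η')
      (by rwa [add_sub_cancel])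
    rw [add_sub_cancel] at key
    have key' := ENNReal.ofReal_le_ofReal key
    have hp1 := frequencyProfile_nonneg (max (-s) 0) a (η 1)
    have hp2 := japanese_pos (|η' 0| - dispersion β (η' 1))
    have hp3 := japanese_pos (|(η - η') 0| - dispersion β ((η - η') 1))
    have hp4 := xWeight_pos β s b η'
    have hp5 := xWeight_pos β s b (η - η')
    rw [ENNReal.ofReal_mul (by positivity), ENNReal.ofReal_mul (by positivity),
      ENNReal.ofReal_mul (by positivity), ENNReal.ofReal_mul hp4.le,
      ENNReal.ofReal_add (by positivity) (by positivity), ENNReal.ofReal_ofNat] at key'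
    calc _ ≤ _ := mul_le_mul_left key' _
      _ = _ := by simp only [hF, hG, hk, hh]; ring
  have hmeas : ∀ {F G : Plane → ℝ≥0∞}, Measurable F → Measurable G →
      Measurable fun η : Plane => h (η 1) * ∫⁻ η', k η' * F η' * G (η - η') := by
    intro F G hF hG
    refine (hhm.comp (by fun_prop)).mul ?_
    apply Measurable.lintegral_prod_right'
      (f := fun q : Plane × Plane => k q.2 * F q.2 * G (q.1 - q.2))
    fun_prop
  have e1 := lintegral_profile_mul_convolution_sq_le hhm hkm hFm hGm hkK
  have e2 := lintegral_profile_mul_convolution_sq_le hhm hkm hGm hFm hkK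
  calc _ ≤ ∫⁻ η, 2 * ((h (η 1) * (∫⁻ η', k η' * F η' * G (η - η'))) ^ 2 +
          (h (η 1) * (∫⁻ η', k η' * G η' * F (η - η'))) ^ 2) := by
        refine lintegral_mono_ae ?_
        filter_upwards [ae_frequency_ne_zero] with η hη
        exact (pow_le_pow_left₀ zero_le (hpt η hη) 2).trans (ENNReal.add_sq_le_two_mul _ _)
    _ ≤ 2 * ((∫⁻ ξ, h ξ ^ 2) * (K * ((∫⁻ η, F η ^ 2) * ∫⁻ η, G η ^ 2)) +
          (∫⁻ ξ, h ξ ^ 2) * (K * ((∫⁻ η, G η ^ 2) * ∫⁻ η, F η ^ 2))) := by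
        rw [lintegral_const_mul' _ _ (by norm_num),
          lintegral_add_left ((hmeas hFm hGm).pow_const 2)]
        gcongr
    _ = _ := by ring

/-! ### Tempered distributions with a square integrable weighted Fourier transform -/

theorem quasiMeasurePreserving_smul {c : ℝ} (hc : c ≠ 0) :
    Measure.QuasiMeasurePreserving (fun η : Plane => c • η) volume volume := by
  refine ⟨by fun_prop, ?_⟩
  rw [Measure.map_addHaar_smul volume hc]
  exact Measure.smul_absolutelyContinuous

theorem HasSpaceTimeFourier.congr {u : 𝓢'(Plane, ℂ)} {f g : Plane → ℂ}
    (hf : HasSpaceTimeFourier u f) (h : f =ᵐ[volume] g) : HasSpaceTimeFourier u g := by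
  have hd : (fun ζ : Plane => f ((2 * Real.pi) • ζ)) =ᵐ[volume]
      (fun ζ : Plane => g ((2 * Real.pi) • ζ)) :=
    (quasiMeasurePreserving_smul (by positivity : (2 * Real.pi) ≠ 0)).ae_eq_comp h
  refine ⟨hf.1.congr h, fun φ => ?_⟩
  have hd' : (fun ζ : Plane => φ ζ * f ((2 * Real.pi) • ζ)) =ᵐ[volume]
      (fun ζ : Plane => φ ζ * g ((2 * Real.pi) • ζ)) := by
    filter_upwards [hd] with ζ hζ
    rw [hζ]
  exact ⟨(hf.2 φ).1.congr hd', (hf.2 φ).2.trans (integral_congr_ae hd')⟩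

theorem HasSpaceTimeFourier.add {u v : 𝓢'(Plane, ℂ)} {f g : Plane → ℂ}
    (hf : HasSpaceTimeFourier u f) (hg : HasSpaceTimeFourier v g) :
    HasSpaceTimeFourier (u + v) (fun η => f η + g η) := by
  refine ⟨hf.1.add hg.1, fun φ => ?_⟩
  simp only [mul_add]
  refine ⟨(hf.2 φ).1.add (hg.2 φ).1, ?_⟩
  rw [integral_add (hf.2 φ).1 (hg.2 φ).1, ← (hf.2 φ).2, ← (hg.2 φ).2]
  rfl

theorem HasSpaceTimeFourier.sub {u v : 𝓢'(Plane, ℂ)} {f g : Plane → ℂ}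
    (hf : HasSpaceTimeFourier u f) (hg : HasSpaceTimeFourier v g) :
    HasSpaceTimeFourier (u - v) (fun η => f η - g η) := by
  refine ⟨hf.1.sub hg.1, fun φ => ?_⟩
  simp only [mul_sub]
  refine ⟨(hf.2 φ).1.sub (hg.2 φ).1, ?_⟩
  rw [integral_sub (hf.2 φ).1 (hg.2 φ).1, ← (hf.2 φ).2, ← (hg.2 φ).2]
  rfl

/-- The weights grow at most polynomially, for all exponents. -/
theorem exists_xWeight_le_pow {β : ℝ} (hβ : β = 1 ∨ β = -1) (s b : ℝ) :
    ∃ k : ℕ, ∀ η : Plane, xWeight β s b η ≤ (1 + ‖η‖) ^ k := by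
  obtain ⟨m, hm⟩ := exists_nat_ge b
  obtain ⟨n, hn⟩ := exists_nat_ge s
  refine ⟨3 * m + n, fun η => ?_⟩
  have h0 : |η 0| ≤ ‖η‖ := PiLp.norm_apply_le η 0
  have h1 : |η 1| ≤ ‖η‖ := PiLp.norm_apply_le η 1
  have hN := norm_nonneg η
  have hd : dispersion β (η 1) ≤ ‖η‖ * (1 + ‖η‖ ^ 2) := by
    refine (dispersion_le hβ _).trans ?_
    rw [← sq_abs]
    gcongr
  have hJ0 : japanese (|η 0| - dispersion β (η 1)) ≤ (1 + ‖η‖) ^ 3 := by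
    unfold japanese
    have := abs_sub (|η 0|) (dispersion β (η 1))
    rw [abs_abs, abs_of_nonneg (dispersion_nonneg _ _)] at this
    nlinarith [sq_nonneg ‖η‖]
  have hJ1 : japanese (η 1) ≤ 1 + ‖η‖ := by unfold japanese; linarith
  rw [pow_add, pow_mul]
  refine mul_le_mul ?_ ?_ (Real.rpow_nonneg (japanese_pos _).le _) (by positivity)
  · refine (rpow_japanese_le hm).trans ?_
    rw [Real.rpow_natCast]
    exact pow_le_pow_left₀ (japanese_pos _).le hJ0 _
  · refine (rpow_japanese_le hn).trans ?_
    rw [Real.rpow_natCast]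
    exact pow_le_pow_left₀ (japanese_pos _).le hJ1 _

theorem xWeight_mul_xWeight_neg (β s b : ℝ) (η : Plane) :
    xWeight β s b η * xWeight β (-s) (-b) η = 1 := by
  have h0 := japanese_pos (|η 0| - dispersion β (η 1))
  have h1 := japanese_pos (η 1)
  unfold xWeight
  rw [Real.rpow_neg h0.le, Real.rpow_neg h1.le]
  field_simp

/-- A function that is square integrable after division by a polynomial is the Fourier transform of
a tempered distribution. -/
theorem exists_hasSpaceTimeFourier_of_memLp {f : Plane → ℂ} (k : ℕ)
    (h : MemLp (fun η : Plane => (((1 + ‖η‖ ^ 2) ^ k : ℝ) : ℂ)⁻¹ * f η) 2 volume) :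
    ∃ u : 𝓢'(Plane, ℂ), HasSpaceTimeFourier u f := by
  have hpi : (2 * Real.pi) ≠ 0 := by positivity
  -- `f` is a polynomial times an `L²` function, in the dilated variable `ζ = (2π)⁻¹ η`.
  set p : Plane → ℂ := fun ζ => (((1 + ‖(2 * Real.pi) • ζ‖ ^ 2) ^ k : ℝ) : ℂ) with hp
  have hp0 : ∀ ζ, p ζ ≠ 0 := fun ζ => by
    simp only [hp]
    exact_mod_cast (by positivity : (1 + ‖(2 * Real.pi) • ζ‖ ^ 2) ^ k ≠ 0)
  have hpt : p.HasTemperateGrowth := by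
    have h1 : (fun ζ : Plane => ‖ζ‖ ^ 2).HasTemperateGrowth := by fun_prop
    have h2 : (fun ζ : Plane => (1 + (2 * Real.pi) ^ 2 * ‖ζ‖ ^ 2) ^ k).HasTemperateGrowth := by
      fun_prop
    have h3 : p = Complex.ofRealCLM ∘ fun ζ : Plane => (1 + (2 * Real.pi) ^ 2 * ‖ζ‖ ^ 2) ^ k := by
      funext ζ
      simp [hp, norm_smul, mul_pow]
    rw [h3]
    exact Complex.ofRealCLM.hasTemperateGrowth.comp h2
  have hG : MemLp (fun ζ : Plane => (p ζ)⁻¹ * f ((2 * Real.pi) • ζ)) 2 volume := by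
    have h1 : MemLp (fun η : Plane => (((1 + ‖η‖ ^ 2) ^ k : ℝ) : ℂ)⁻¹ * f η) 2
        (Measure.map (fun η : Plane => (2 * Real.pi) • η) volume) := by
      rw [Measure.map_addHaar_smul volume hpi]
      exact h.smul_measure ENNReal.ofReal_ne_top
    exact (memLp_map_measure_iff h1.1 (by fun_prop)).1 h1
  have hfm : AEStronglyMeasurable f volume := by
    have h1 : AEStronglyMeasurable (fun η : Plane => (((1 + ‖η‖ ^ 2) ^ k : ℝ) : ℂ)) volume :=
      Continuous.aestronglyMeasurable (by fun_prop)
    refine (h1.mul h.1).congr (Filter.Eventually.of_forall fun η => ?_)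
    have h2 : (((1 + ‖η‖ ^ 2) ^ k : ℝ) : ℂ) ≠ 0 := by
      exact_mod_cast (by positivity : (1 + ‖η‖ ^ 2) ^ k ≠ 0)
    simp only [Pi.mul_apply]
    rw [mul_inv_cancel_left₀ h2]
  have hval : ∀ (φ : 𝓢(Plane, ℂ)) (ζ : Plane), SchwartzMap.smulLeftCLM ℂ p φ ζ *
      ((p ζ)⁻¹ * f ((2 * Real.pi) • ζ)) = φ ζ * f ((2 * Real.pi) • ζ) := by
    intro φ ζ
    rw [SchwartzMap.smulLeftCLM_apply_apply hpt, smul_eq_mul]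
    have := hp0 ζ
    field_simp
  refine ⟨𝓕⁻ (TemperedDistribution.smulLeftCLM ℂ p (Lp.toTemperedDistribution hG.toLp)), hfm,
    fun φ => ⟨?_, ?_⟩⟩
  · refine (((SchwartzMap.smulLeftCLM ℂ p φ).memLp 2).integrable_mul hG).congr
      (Filter.Eventually.of_forall fun ζ => ?_)
    exact hval φ ζ
  · rw [FourierTransform.fourier_fourierInv_eq, TemperedDistribution.smulLeftCLM_apply_apply,
      Lp.toTemperedDistribution_apply]
    refine integral_congr_ae ?_
    filter_upwards [hG.coeFn_toLp] with ζ hζ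
    rw [hζ, smul_eq_mul, hval]

/-- Every measurable function with finite weighted norm is the Fourier transform of a tempered
distribution. -/
theorem exists_hasSpaceTimeFourier {β : ℝ} (hβ : β = 1 ∨ β = -1) {s b : ℝ} {f : Plane → ℂ}
    (hf : AEStronglyMeasurable f volume)
    (h : eLpNorm (fun η => (xWeight β s b η : ℂ) * f η) 2 volume < ∞) :
    ∃ u : 𝓢'(Plane, ℂ), HasSpaceTimeFourier u f := by
  obtain ⟨k, hk⟩ := exists_xWeight_le_pow hβ (-s) (-b)
  have hm : AEStronglyMeasurable (fun η => (xWeight β s b η : ℂ) * f η) volume :=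
    (Complex.continuous_ofReal.comp (continuous_xWeight β s b)).aestronglyMeasurable.mul hf
  refine exists_hasSpaceTimeFourier_of_memLp k
    (MemLp.of_le_mul (c := 2 ^ k) ⟨hm, h⟩ ?_ (Filter.Eventually.of_forall fun η => ?_))
  · refine AEStronglyMeasurable.mul (Continuous.aestronglyMeasurable ?_) hf
    refine Continuous.inv₀ (by fun_prop) fun η => ?_
    exact_mod_cast (by positivity : (1 + ‖η‖ ^ 2) ^ k ≠ 0)
  · have hW := xWeight_pos β s b η
    rw [norm_mul, norm_mul, norm_inv, Complex.norm_real, Complex.norm_real, Real.norm_of_nonneg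
      hW.le, Real.norm_of_nonneg (by positivity), ← mul_assoc]
    refine mul_le_mul_of_nonneg_right ?_ (norm_nonneg _)
    rw [inv_le_iff_one_le_mul₀ (by positivity)]
    calc (1 : ℝ) = xWeight β s b η * xWeight β (-s) (-b) η :=
          (xWeight_mul_xWeight_neg β s b η).symm
      _ ≤ xWeight β s b η * (2 * (1 + ‖η‖ ^ 2)) ^ k := by
          refine mul_le_mul_of_nonneg_left ((hk η).trans ?_) hW.le
          refine pow_le_pow_left₀ (by positivity) ?_ _
          nlinarith [sq_nonneg (‖η‖ - 1), sq_nonneg ‖η‖]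
      _ = _ := by rw [mul_pow]; ring

/-- The measure with density `xWeight ^ 2`, so that `û ∈ L²` of it means that `xNorm` is finite. -/
noncomputable def xMeasure (β s b : ℝ) : Measure Plane :=
  volume.withDensity fun η => ENNReal.ofReal (xWeight β s b η ^ 2)

theorem measurable_xWeight_sq (β s b : ℝ) :
    Measurable fun η : Plane => ENNReal.ofReal (xWeight β s b η ^ 2) :=
  ((continuous_xWeight β s b).pow 2).measurable.ennreal_ofReal

theorem eLpNorm_xMeasure (β s b : ℝ) (f : Plane → ℂ) :
    eLpNorm f 2 (xMeasure β s b) = eLpNorm (fun η => (xWeight β s b η : ℂ) * f η) 2 volume := by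
  rw [eLpNorm_eq_lintegral_rpow_enorm_toReal (by norm_num) (by norm_num),
    eLpNorm_eq_lintegral_rpow_enorm_toReal (by norm_num) (by norm_num), xMeasure,
    lintegral_withDensity_eq_lintegral_mul_non_measurable _ (measurable_xWeight_sq β s b)
      (Filter.Eventually.of_forall fun η => ENNReal.ofReal_lt_top)]
  congr 1
  refine lintegral_congr fun η => ?_
  have hW := xWeight_pos β s b η
  simp only [Pi.mul_apply, enorm_mul, ENNReal.toReal_ofNat, ENNReal.rpow_ofNat, mul_pow]
  congr 1
  rw [← ofReal_norm, Complex.norm_real, Real.norm_of_nonneg hW.le, ENNReal.ofReal_pow hW.le]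

theorem hasTemperateGrowth_xMeasure {β : ℝ} (hβ : β = 1 ∨ β = -1) (s b : ℝ) :
    (xMeasure β s b).HasTemperateGrowth := by
  obtain ⟨k, hk⟩ := exists_xWeight_le_pow hβ s b
  refine ⟨2 * k + 3, ?_⟩
  rw [xMeasure, integrable_withDensity_iff (measurable_xWeight_sq β s b)
    (Filter.Eventually.of_forall fun η => ENNReal.ofReal_lt_top)]
  have h3 : Integrable (fun η : Plane => (1 + ‖η‖) ^ (-(3 : ℝ))) volume :=
    integrable_one_add_norm (by norm_num)
  have hc : Continuous fun η : Plane => (1 + ‖η‖) ^ (-((2 * k + 3 : ℕ) : ℝ)) :=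
    (by fun_prop : Continuous fun η : Plane => 1 + ‖η‖).rpow_const
      fun η => Or.inl (by positivity)
  refine h3.mono' ?_ (Filter.Eventually.of_forall fun η => ?_)
  · exact hc.aestronglyMeasurable.mul
      (measurable_xWeight_sq β s b).ennreal_toReal.aestronglyMeasurable
  · have hW := xWeight_pos β s b η
    have hN : 0 < 1 + ‖η‖ := by positivity
    rw [ENNReal.toReal_ofReal (by positivity), Real.norm_of_nonneg (by positivity)]
    calc (1 + ‖η‖) ^ (-((2 * k + 3 : ℕ) : ℝ)) * xWeight β s b η ^ 2
        ≤ (1 + ‖η‖) ^ (-((2 * k + 3 : ℕ) : ℝ)) * ((1 + ‖η‖) ^ k) ^ 2 := by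
          gcongr
          exact hk η
      _ = _ := by
          rw [← pow_mul, ← Real.rpow_natCast (1 + ‖η‖) (k * 2), ← Real.rpow_add hN]
          congr 1
          push_cast
          ring


theorem exists_schwartz_comp_smul {c : ℝ} (hc : c ≠ 0) (φ : 𝓢(Plane, ℂ)) :
    ∃ ψ : 𝓢(Plane, ℂ), ∀ η, ψ η = φ (c • η) :=
  ⟨SchwartzMap.compCLMOfContinuousLinearEquiv ℂ
    (ContinuousLinearEquiv.smulLeft (Units.mk0 c hc)) φ, fun _ => rfl⟩

theorem exists_schwartz_eq_spaceTimeFourier (φ : 𝓢(Plane, ℂ)) :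
    ∃ ψ : 𝓢(Plane, ℂ), ⇑ψ = spaceTimeFourier φ := by
  obtain ⟨ψ, hψ⟩ := exists_schwartz_comp_smul
    (inv_ne_zero (by positivity : (2 * Real.pi) ≠ 0)) (𝓕 φ)
  exact ⟨ψ, funext fun η => by rw [hψ, spaceTimeFourier_eq]⟩

theorem exists_spaceTimeFourier_eq_schwartz (ψ : 𝓢(Plane, ℂ)) :
    ∃ φ : 𝓢(Plane, ℂ), spaceTimeFourier φ = ψ := by
  have hpi : (2 * Real.pi) ≠ 0 := by positivity
  obtain ⟨χ, hχ⟩ := exists_schwartz_comp_smul hpi ψ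
  refine ⟨𝓕⁻ χ, funext fun η => ?_⟩
  rw [spaceTimeFourier_eq, FourierTransform.fourier_fourierInv_eq, hχ, smul_smul,
    mul_inv_cancel₀ hpi, one_smul]

theorem exists_of_mem_XSpace {β : ℝ} (hβ : β = 1 ∨ β = -1) {s b : ℝ} {u : 𝓢'(Plane, ℂ)}
    (hu : u ∈ XSpace β s b) :
    ∃ f : Plane → ℂ, HasSpaceTimeFourier u f ∧
      eLpNorm (fun η => (xWeight β s b η : ℂ) * f η) 2 volume < ∞ := by
  obtain ⟨φ, hφ⟩ := hu 1 one_pos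
  unfold xNorm at hφ
  simp only [iInf_lt_iff] at hφ
  obtain ⟨g, hg, hlt⟩ := hφ
  have := hasTemperateGrowth_xMeasure hβ s b
  obtain ⟨ψ, hψ⟩ := exists_schwartz_eq_spaceTimeFourier φ
  refine ⟨_, by simpa using hg.add (hasSpaceTimeFourier_schwartz φ), ?_⟩
  rw [← eLpNorm_xMeasure] at hlt ⊢
  have hgm : MemLp g 2 (xMeasure β s b) :=
    ⟨hg.1.mono_ac (withDensity_absolutelyContinuous _ _), hlt.trans ENNReal.one_lt_top⟩
  rw [← hψ]
  exact (hgm.add (ψ.memLp 2 (xMeasure β s b))).2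

/-- A finite norm suffices for membership, since test functions are dense in the weighted `L²`
space on the Fourier side. -/
theorem mem_XSpace_of_eLpNorm_lt_top {β : ℝ} (hβ : β = 1 ∨ β = -1) {s b : ℝ} {u : 𝓢'(Plane, ℂ)}
    {f : Plane → ℂ} (hf : HasSpaceTimeFourier u f)
    (h : eLpNorm (fun η => (xWeight β s b η : ℂ) * f η) 2 volume < ∞) :
    u ∈ XSpace β s b := by
  intro ε hε
  have := hasTemperateGrowth_xMeasure hβ s b
  obtain ⟨δ, hδ, hδε⟩ := ENNReal.lt_iff_exists_nnreal_btwn.1 hε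
  have hfm : MemLp f 2 (xMeasure β s b) :=
    ⟨hf.1.mono_ac (withDensity_absolutelyContinuous _ _), by rwa [eLpNorm_xMeasure]⟩
  have : IsLocallyFiniteMeasure (xMeasure β s b) :=
    IsLocallyFiniteMeasure.withDensity_ofReal ((continuous_xWeight β s b).pow 2)
  obtain ⟨g, hg1, hg2, hg3⟩ := hfm.exist_eLpNorm_sub_le (by norm_num) (by norm_num)
    (NNReal.coe_pos.2 (ENNReal.coe_pos.1 hδ))
  obtain ⟨φ, hφ⟩ := exists_spaceTimeFourier_eq_schwartz (hg1.toSchwartzMap hg2)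
  refine ⟨φ, ?_⟩
  rw [(hf.sub (hasSpaceTimeFourier_schwartz φ)).xNorm_eq, ← eLpNorm_xMeasure, hφ]
  refine lt_of_le_of_lt ?_ hδε
  rw [ENNReal.ofReal_coe_nnreal] at hg3
  exact hg3

/-! ### The product estimate -/

theorem enorm_xWeight (β s b : ℝ) (η : Plane) :
    ‖(xWeight β s b η : ℂ)‖ₑ = ENNReal.ofReal (xWeight β s b η) := by
  rw [← ofReal_norm, Complex.norm_real, Real.norm_of_nonneg (xWeight_pos β s b η).le]

theorem eLpNorm_two_sq {α : Type*} [MeasurableSpace α] (μ : Measure α) (f : α → ℂ) :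
    eLpNorm f 2 μ ^ 2 = ∫⁻ x, ‖f x‖ₑ ^ 2 ∂μ := by
  rw [eLpNorm_eq_lintegral_rpow_enorm_toReal (by norm_num) (by norm_num)]
  simp only [ENNReal.toReal_ofNat, ENNReal.rpow_ofNat, ENNReal.sq_rpow_half]

/-- The multiplier gains one derivative. -/
theorem xWeight_mul_norm_nonlinearMultiplier_le {β : ℝ} (hβ : β = 1 ∨ β = -1) (s b : ℝ)
    (η : Plane) :
    xWeight β s b η * ‖nonlinearMultiplier β η‖ ≤ 2 * xWeight β (s - 1) b η := by
  have h := norm_nonlinearMultiplier_le hβ η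
  have hW := xWeight_pos β s b η
  calc _ ≤ xWeight β s b η * (2 * (japanese (η 1))⁻¹) := by gcongr
    _ = _ := by
      unfold xWeight
      rw [Real.rpow_sub_one (japanese_pos _).ne']
      ring

/-- The bilinear estimate for the convolution of complex functions. The loss `⟨ξ⟩^{s - 1}` in place
of `⟨ξ⟩^s` is what the multiplier compensates; stating it without the multiplier, which vanishes at
`ξ = 0`, also shows that the convolution itself is a tempered distribution. -/
theorem exists_eLpNorm_convolution_le {s a b : ℝ} (hb : 1 / 2 < b) (ha : 0 ≤ a)
    (ha' : a < 1 / 2) (hsa : -s ≤ a) :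
    ∃ C : ℝ≥0∞, C < ∞ ∧ ∀ β : ℝ, (β = 1 ∨ β = -1) → ∀ f g : Plane → ℂ, Measurable f →
      Measurable g →
      eLpNorm (fun η => (xWeight β s b η : ℂ) * f η) 2 volume < ∞ →
      eLpNorm (fun η => (xWeight β s b η : ℂ) * g η) 2 volume < ∞ →
      (∀ᵐ η : Plane, Integrable (fun η' : Plane => f η' * g (η - η')) volume) ∧
      eLpNorm (fun η => (xWeight β (s - 1) (-a) η : ℂ) * ∫ η' : Plane, f η' * g (η - η')) 2 volume ≤
        C * (eLpNorm (fun η => (xWeight β s b η : ℂ) * f η) 2 volume *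
          eLpNorm (fun η => (xWeight β s b η : ℂ) * g η) 2 volume) := by
  obtain ⟨C, hC, hbil⟩ := exists_lintegral_convolution_le hb ha ha' hsa
  refine ⟨C ^ (1 / 2 : ℝ), ENNReal.rpow_lt_top_of_nonneg (by norm_num) hC.ne,
    fun β hβ f g hf hg hfN hgN => ?_⟩
  have key := hbil β hβ (fun η => ‖f η‖ₑ) (fun η => ‖g η‖ₑ) hf.enorm hg.enorm
  have hnorm : ∀ f : Plane → ℂ, ∫⁻ η, (ENNReal.ofReal (xWeight β s b η) * ‖f η‖ₑ) ^ 2 =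
      eLpNorm (fun η => (xWeight β s b η : ℂ) * f η) 2 volume ^ 2 := by
    intro f
    rw [eLpNorm_two_sq]
    simp only [enorm_mul, enorm_xWeight]
  rw [hnorm, hnorm] at key
  have hmD : Measurable fun η : Plane => ∫⁻ η', ‖f η'‖ₑ * ‖g (η - η')‖ₑ := by
    apply Measurable.lintegral_prod_right'
      (f := fun q : Plane × Plane => ‖f q.2‖ₑ * ‖g (q.1 - q.2)‖ₑ)
    fun_prop
  have hWm : Measurable fun η : Plane => ENNReal.ofReal (xWeight β (s - 1) (-a) η) :=
    (continuous_xWeight β (s - 1) (-a)).measurable.ennreal_ofReal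
  constructor
  · have hfin := ae_lt_top ((hWm.mul hmD).pow_const 2) (key.trans_lt (ENNReal.mul_lt_top hC
      (ENNReal.mul_lt_top (ENNReal.pow_lt_top hfN) (ENNReal.pow_lt_top hgN)))).ne
    filter_upwards [hfin] with η hη
    refine ⟨(hf.mul (hg.comp (measurable_const.sub measurable_id))).aestronglyMeasurable, ?_⟩
    have hW : ENNReal.ofReal (xWeight β (s - 1) (-a) η) ≠ 0 :=
      (ENNReal.ofReal_pos.2 (xWeight_pos _ _ _ _)).ne'
    rw [hasFiniteIntegral_iff_enorm]
    simp only [enorm_mul]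
    by_contra! htop
    rw [top_le_iff] at htop
    simp [htop, ENNReal.mul_top hW] at hη
  · refine (ENNReal.pow_le_pow_left_iff two_ne_zero).1 ?_
    rw [eLpNorm_two_sq, mul_pow, mul_pow, ENNReal.sq_rpow_half]
    refine (lintegral_mono fun η => ?_).trans key
    rw [enorm_mul, enorm_xWeight]
    gcongr
    refine (enorm_integral_le_lintegral_enorm _).trans (le_of_eq ?_)
    simp only [enorm_mul]

theorem theorem3p1 (s a b : ℝ) (hb : 1 / 2 < b) (ha : 1 / 6 < a) (ha' : a < 1 / 2)
    (hs : 0 ≤ s ∨ (-(1 / 2) < s ∧ s < 0 ∧ |s| < a)) :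
    ∃ c : ℝ, 0 < c ∧ ∀ β : ℝ, (β = 1 ∨ β = -1) →
      ∀ u ∈ XSpace β s b, ∀ v ∈ XSpace β s b,
        ∃ P w : 𝓢'(Plane, ℂ), IsProduct u v P ∧
          IsMultiplied (nonlinearMultiplier β) P w ∧
          w ∈ XSpace β s (-a) ∧
          xNorm β s (-a) w ≤ ENNReal.ofReal c * xNorm β s b u * xNorm β s b v := by
  have hsa : -s ≤ a := by
    rcases hs with h | ⟨_, _, h⟩
    · linarith
    · exact (neg_le_abs s).trans h.le
  obtain ⟨C, hC, hbil⟩ := exists_eLpNorm_convolution_le (s := s) hb (by linarith) ha' hsa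
  refine ⟨2 * C.toReal + 1, by positivity, fun β hβ u hu v hv => ?_⟩
  obtain ⟨f₀, hf₀, hf₀N⟩ := exists_of_mem_XSpace hβ hu
  obtain ⟨g₀, hg₀, hg₀N⟩ := exists_of_mem_XSpace hβ hv
  -- Measurable representatives, so that the convolution integrals below are measurable.
  obtain ⟨f, hfm, hff⟩ : ∃ f, Measurable f ∧ f₀ =ᵐ[volume] f :=
    ⟨hf₀.1.mk f₀, hf₀.1.stronglyMeasurable_mk.measurable, hf₀.1.ae_eq_mk⟩
  obtain ⟨g, hgm, hgg⟩ : ∃ g, Measurable g ∧ g₀ =ᵐ[volume] g :=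
    ⟨hg₀.1.mk g₀, hg₀.1.stronglyMeasurable_mk.measurable, hg₀.1.ae_eq_mk⟩
  have hf := hf₀.congr hff
  have hg := hg₀.congr hgg
  rw [← hf₀.xNorm_eq, hf.xNorm_eq] at hf₀N
  rw [← hg₀.xNorm_eq, hg.xNorm_eq] at hg₀N
  obtain ⟨hint, hle⟩ := hbil β hβ f g hfm hgm hf₀N hg₀N
  set Q : Plane → ℂ := fun η =>
    ((2 * Real.pi) ^ 2 : ℂ)⁻¹ * ∫ η' : Plane, f η' * g (η - η') with hQ
  have hc0 : ‖((2 * Real.pi) ^ 2 : ℂ)⁻¹‖ ≤ 1 := by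
    rw [norm_inv, norm_pow, norm_mul, Complex.norm_real, Complex.norm_ofNat,
      Real.norm_of_nonneg Real.pi_pos.le]
    refine inv_le_one_of_one_le₀ (one_le_pow₀ ?_)
    linarith [Real.pi_gt_three]
  have hQm : AEStronglyMeasurable Q volume := by
    refine AEStronglyMeasurable.const_mul (StronglyMeasurable.aestronglyMeasurable ?_) _
    apply StronglyMeasurable.integral_prod_right'
      (f := fun q : Plane × Plane => f q.2 * g (q.1 - q.2))
    exact Measurable.stronglyMeasurable (by fun_prop)
  have hQle : eLpNorm (fun η => (xWeight β (s - 1) (-a) η : ℂ) * Q η) 2 volume ≤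
      C * (eLpNorm (fun η => (xWeight β s b η : ℂ) * f η) 2 volume *
          eLpNorm (fun η => (xWeight β s b η : ℂ) * g η) 2 volume) := by
    refine (eLpNorm_mono fun η => ?_).trans hle
    rw [hQ, norm_mul, norm_mul, norm_mul]
    refine mul_le_mul_of_nonneg_left ?_ (norm_nonneg _)
    exact mul_le_of_le_one_left (norm_nonneg _) hc0
  have hprod : C * (eLpNorm (fun η => (xWeight β s b η : ℂ) * f η) 2 volume *
      eLpNorm (fun η => (xWeight β s b η : ℂ) * g η) 2 volume) < ∞ :=
    ENNReal.mul_lt_top hC (ENNReal.mul_lt_top hf₀N hg₀N)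
  obtain ⟨P, hP⟩ := exists_hasSpaceTimeFourier hβ hQm (hQle.trans_lt hprod)
  have hmm : AEStronglyMeasurable (fun η => nonlinearMultiplier β η * Q η) volume := by
    refine AEStronglyMeasurable.mul (Measurable.aestronglyMeasurable ?_) hQm
    have h1 : Measurable fun η : Plane => dispersion β (η 1) :=
      (continuous_dispersion β).measurable.comp (by fun_prop)
    unfold nonlinearMultiplier
    fun_prop
  have hwle : eLpNorm (fun η => (xWeight β s (-a) η : ℂ) * (nonlinearMultiplier β η * Q η)) 2
      volume ≤ ENNReal.ofReal 2 *
        eLpNorm (fun η => (xWeight β (s - 1) (-a) η : ℂ) * Q η) 2 volume := by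
    refine eLpNorm_le_mul_eLpNorm_of_ae_le_mul (Filter.Eventually.of_forall fun η => ?_) 2
    generalize Q η = z
    rw [norm_mul, norm_mul, norm_mul, Complex.norm_real, Complex.norm_real,
      Real.norm_of_nonneg (xWeight_pos _ _ _ _).le, Real.norm_of_nonneg (xWeight_pos _ _ _ _).le,
      ← mul_assoc, ← mul_assoc]
    exact mul_le_mul_of_nonneg_right (xWeight_mul_norm_nonlinearMultiplier_le hβ s (-a) η)
      (norm_nonneg _)
  have hwfin := hwle.trans_lt (ENNReal.mul_lt_top ENNReal.ofReal_lt_top (hQle.trans_lt hprod))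
  obtain ⟨w, hw⟩ := exists_hasSpaceTimeFourier hβ hmm hwfin
  refine ⟨P, w, ⟨f, g, hf, hg, hint, hP⟩, ⟨Q, hP, hw⟩, mem_XSpace_of_eLpNorm_lt_top hβ hw hwfin, ?_⟩
  rw [hw.xNorm_eq, hf.xNorm_eq, hg.xNorm_eq]
  refine (hwle.trans (mul_le_mul_right hQle _)).trans ?_
  rw [← mul_assoc, mul_assoc (ENNReal.ofReal (2 * C.toReal + 1))]
  refine mul_le_mul_left ?_ _
  calc ENNReal.ofReal 2 * C = ENNReal.ofReal (2 * C.toReal) := by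
        rw [ENNReal.ofReal_mul (by norm_num), ENNReal.ofReal_toReal hC.ne]
    _ ≤ _ := ENNReal.ofReal_le_ofReal (by linarith)
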